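/- **Theorem 1 (Main Theorem).** A homogeneous polynomial $p\in\mathbb{R}[x_1,\dots,x_n]$ of degree $d$ is *hyperbolic* with respect to a direction $e\in\mathbb{R}^n$ if $p(e)\neq 0$ and for every $x\in\mathbb{R}^n$ all roots of the univariate polynomial $t\mapsto p(te+x)$ are real. Its hyperbolicity cone is then $$K_p=\{x\in\mathbb{R}^n : \text{all roots of } t\mapsto p(te+x)\text{ are non-positive}\}.$$ A *spectrahedral cone of dimension $B$* in $\mathbb{R}^n$ is a set of the form $\{x\in\mathbb{R}^n:\sum_{i=1}^n x_iA_i\succeq 0\}$ with $A_1,\dots,A_n\in\mathbb{R}^{B\times B}$, where $M\succeq 0$ means that $M$ is symmetric positive semidefinite. For two closed cones $K,K'\subseteq\mathbb{R}^n$ put $$\mathrm{hdist}(K,K')=\max\Big\{\sup_{x\in \mathcal{B}\cap K} d(x,K'),\ \sup_{y\in \mathcal{B}\cap K'} d(y,K)\Big\},$$ where $\mathcal{B}$ is the closed Euclidean unit ball of $\mathbb{R}^n$ and $d$ the Euclidean distance. A spectrahedral cone $K'$ is an *$\eta$-approximate spectrahedral representation* of $K$ if $\mathrm{hdist}(K,K')\le\eta$.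 There exist an absolute constant $\kappa>0$ and an $N_0\in\mathbb{N}$ such that for all integers $n,d\ge N_0$ there exists a polynomial $p\in\mathbb{R}[x_1,\dots,x_n]$, homogeneous of degree $d$ and hyperbolic with respect to some direction $e\in\mathbb{R}^n$, whose hyperbolicity cone $K_p$ does not admit an $\eta$-approximate spectrahedral representation of any dimension $B\le (n/d)^{\kappa d}$, for $\eta=1/n^{4nd}$. -/

import Mathlib

open scoped ENNReal

/-- The univariate restriction `t ↦ p (t e + x)`, as a polynomial in `t`. -/
noncomputable def lineRestriction {n : ℕ} (p : MvPolynomial (Fin n) ℝ)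
    (e x : EuclideanSpace ℝ (Fin n)) : Polynomial ℝ :=
  MvPolynomial.aeval (fun i => Polynomial.C (e i) * Polynomial.X + Polynomial.C (x i)) p

/-- `p` is homogeneous of degree `d` and hyperbolic with respect to the direction `e`:
`p e ≠ 0` and every restriction `p (t e + x)` has only real roots, i.e. splits over `ℝ`.
(As `p e ≠ 0`, no restriction is the zero polynomial.) -/
structure IsHyperbolic {n : ℕ} (d : ℕ) (p : MvPolynomial (Fin n) ℝ)
    (e : EuclideanSpace ℝ (Fin n)) : Prop where
  homogeneous : p.IsHomogeneous d
  eval_ne_zero : MvPolynomial.eval (fun i => e i) p ≠ 0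
  realRooted : ∀ x : EuclideanSpace ℝ (Fin n), (lineRestriction p e x).Splits

/-- The (closed) hyperbolicity cone of `p` in direction `e`: the points `x` such that all
roots of `p (t e + x)` are non-positive. -/
def hyperbolicityCone {n : ℕ} (p : MvPolynomial (Fin n) ℝ)
    (e : EuclideanSpace ℝ (Fin n)) : Set (EuclideanSpace ℝ (Fin n)) :=
  {x | ∀ t : ℝ, (lineRestriction p e x).IsRoot t → t ≤ 0}

/-- The spectrahedral cone `{x | ∑ i, x i • A i ⪰ 0}` of a tuple of real `B × B` matrices. -/
def spectrahedralCone {n B : ℕ} (A : Fin n → Matrix (Fin B) (Fin B) ℝ) :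
    Set (EuclideanSpace ℝ (Fin n)) :=
  {x | (∑ i, x i • A i).PosSemidef}

/-- Hausdorff distance of cones: the largest distance from a point of one cone in the closed
Euclidean unit ball to the other cone, taken in `[0, ∞]`. -/
noncomputable def hdist {n : ℕ} (K K' : Set (EuclideanSpace ℝ (Fin n))) : ℝ≥0∞ :=
  max (⨆ x ∈ Metric.closedBall (0 : EuclideanSpace ℝ (Fin n)) 1 ∩ K, Metric.infEDist x K')
    (⨆ y ∈ Metric.closedBall (0 : EuclideanSpace ℝ (Fin n)) 1 ∩ K', Metric.infEDist y K)

/-- The tuple `A` of `B × B` matrices is an `η`-approximate spectrahedral representation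
(of dimension `B`) of the cone `K`. -/
def IsApproxSpectrahedralRep {n B : ℕ} (η : ℝ) (K : Set (EuclideanSpace ℝ (Fin n)))
    (A : Fin n → Matrix (Fin B) (Fin B) ℝ) : Prop :=
  hdist K (spectrahedralCone A) ≤ ENNReal.ofReal η

/-! The proof is a counting argument: there are doubly exponentially many hyperbolicity cones that
differ at a scale well above `η`, and too few spectrahedral cones of small dimension to approximate
them all. Many cones. Take the elementary symmetric polynomial of degree `D = min d ((n - 1) / 2)`,
fix a variable `o`, and change the coefficient of each monomial avoiding `o` by `±ε`, with signs
chosen freely. For tiny `ε` the result is still stable (`perturbedEsum_ne_zero`), hence hyperbolic;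
a power of another variable brings the degree up to `d`. For each `D`-set `S` avoiding `o` there is
a point where the unperturbed polynomial vanishes and the perturbed one equals the perturbation of
the coefficient of `S`, up to a positive factor. The sign of that coefficient decides whether a
whole ball around a nearby point lies inside the cone or outside it. Thus all `2 ^ (n - 1).choose D`
patterns on one fixed family of balls occur (`exists_hyperbolic_test_family`). Few spectrahedra. A
spectrahedral cone close to such a cone contains a fixed ball around `e`
(`closedBall_half_subset_of_infEDist_le`). A congruence then makes the matrix at `e` a 0/1 diagonal
and bounds every entry (`exists_isNormalized`). Rounding the entries leaves finitely many codes, and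
equal codes give cones that agree up to a small shift along `e` (`add_smul_mem_spectrahedralCone`),
so the code determines the pattern (`two_pow_card_le_of_approx`). Taking logarithms, representations
of dimension at most `B` for all patterns would force `(n - 1).choose D ≤ 22 * n ^ 3 * B ^ 2`. This
fails for `B ≤ (n / d) ^ (d / 16)` once `n` and `d` are large (`eventually_lt_choose`). -/

section ElementarySymmetric

/-! ### Quantitative stability of elementary symmetric polynomials. -/

variable {ι : Type*} [DecidableEq ι]

/-- Every `(k + 1)`-subset of `A` arises from `k + 1` pairs of an element and a `k`-subset
avoiding it. -/
theorem sum_powersetCard_erase_insert {M : Type*} [AddCommMonoid M] (A : Finset ι) (k : ℕ)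
    (F : Finset ι → M) :
    ∑ i ∈ A, ∑ T ∈ (A.erase i).powersetCard k, F (insert i T) =
      (k + 1) • ∑ T ∈ A.powersetCard (k + 1), F T := by
  have h : (k + 1) • ∑ T ∈ A.powersetCard (k + 1), F T =
      ∑ T ∈ A.powersetCard (k + 1), ∑ _i ∈ T, F T := by
    rw [Finset.smul_sum]
    refine Finset.sum_congr rfl fun T hT => ?_
    rw [Finset.sum_const, (Finset.mem_powersetCard.1 hT).2]
  rw [h, Finset.sum_sigma', Finset.sum_sigma']
  refine Finset.sum_bij' (fun p _ => ⟨insert p.1 p.2, p.1⟩) (fun p _ => ⟨p.2, p.1.erase p.2⟩)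
    ?_ ?_ ?_ ?_ ?_
  · rintro ⟨i, T⟩ h
    simp only [Finset.mem_sigma, Finset.mem_powersetCard] at h ⊢
    obtain ⟨hi, hT, hc⟩ := h
    have hiT : i ∉ T := fun h => Finset.notMem_erase i A (hT h)
    refine ⟨⟨Finset.insert_subset hi (hT.trans (Finset.erase_subset _ _)), ?_⟩, by simp⟩
    rw [Finset.card_insert_of_notMem hiT, hc]
  · rintro ⟨T, i⟩ h
    simp only [Finset.mem_sigma, Finset.mem_powersetCard] at h ⊢
    obtain ⟨⟨hT, hc⟩, hi⟩ := h
    refine ⟨hT hi, Finset.erase_subset_erase _ hT, ?_⟩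
    rw [Finset.card_erase_of_mem hi, hc]; rfl
  · rintro ⟨i, T⟩ h
    simp only [Finset.mem_sigma, Finset.mem_powersetCard] at h
    have hiT : i ∉ T := fun h' => Finset.notMem_erase i A (h.2.1 h')
    simp [Finset.erase_insert hiT]
  · rintro ⟨T, i⟩ h
    simp only [Finset.mem_sigma, Finset.mem_powersetCard] at h
    simp [Finset.insert_erase h.2]
  · rintro ⟨i, T⟩ h
    rfl

/-- The elementary symmetric polynomial of degree `k` in the variables indexed by `A`. -/
def esum {R : Type*} [CommSemiring R] (A : Finset ι) (k : ℕ) (x : ι → R) : R :=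
  ∑ T ∈ A.powersetCard k, ∏ i ∈ T, x i

theorem sum_powersetCard_succ_erase {M : Type*} [AddCommMonoid M] {A : Finset ι} {i : ι}
    (hi : i ∈ A) (k : ℕ) (F : Finset ι → M) :
    ∑ T ∈ A.powersetCard (k + 1), F T =
      ∑ T ∈ (A.erase i).powersetCard (k + 1), F T +
        ∑ T ∈ (A.erase i).powersetCard k, F (insert i T) := by
  have hn : ∀ {T : Finset ι}, T ⊆ A.erase i → i ∉ T := fun hT h =>
    Finset.notMem_erase i A (hT h)
  conv_lhs => rw [← Finset.insert_erase hi]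
  rw [Finset.powersetCard_succ_insert (Finset.notMem_erase i A), Finset.sum_union,
    Finset.sum_image]
  · intro T hT T' hT' h
    have h1 := hn (Finset.mem_powersetCard.1 hT).1
    have h2 := hn (Finset.mem_powersetCard.1 hT').1
    rw [← Finset.erase_insert h1, ← Finset.erase_insert h2, h]
  · rw [Finset.disjoint_left]
    intro T hT hT'
    obtain ⟨U, -, rfl⟩ := Finset.mem_image.1 hT'
    exact hn (Finset.mem_powersetCard.1 hT).1 (Finset.mem_insert_self _ _)

theorem esum_succ_eq_erase {R : Type*} [CommSemiring R] {A : Finset ι} {i : ι} (hi : i ∈ A)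
    (k : ℕ) (x : ι → R) :
    esum A (k + 1) x = esum (A.erase i) (k + 1) x + x i * esum (A.erase i) k x := by
  unfold esum
  rw [sum_powersetCard_succ_erase hi, Finset.mul_sum]
  congr 1
  refine Finset.sum_congr rfl fun T hT => ?_
  rw [Finset.prod_insert fun h => Finset.notMem_erase i A ((Finset.mem_powersetCard.1 hT).1 h)]

theorem sum_mul_esum_erase {R : Type*} [CommSemiring R] (A : Finset ι) (k : ℕ) (x : ι → R) :
    ∑ i ∈ A, x i * esum (A.erase i) k x = (k + 1 : ℕ) * esum A (k + 1) x := by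
  unfold esum
  rw [← nsmul_eq_mul, ← sum_powersetCard_erase_insert]
  refine Finset.sum_congr rfl fun i _ => ?_
  rw [Finset.mul_sum]
  refine Finset.sum_congr rfl fun T hT => ?_
  rw [Finset.prod_insert fun h => Finset.notMem_erase i A ((Finset.mem_powersetCard.1 hT).1 h)]

/-- `∑ |z_T|² Im z_j` over the `k`-subsets `T` of `A` and `j ∈ A \ T`. -/
noncomputable def imWeight (A : Finset ι) (k : ℕ) (z : ι → ℂ) : ℝ :=
  ∑ T ∈ A.powersetCard k, ∑ j ∈ A \ T, (∏ i ∈ T, ‖z i‖ ^ 2) * (z j).im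

theorem sum_mul_imWeight_erase (A : Finset ι) (k : ℕ) (z : ι → ℂ) :
    ∑ i ∈ A, ‖z i‖ ^ 2 * imWeight (A.erase i) k z = (k + 1 : ℝ) * imWeight A (k + 1) z := by
  unfold imWeight
  have := sum_powersetCard_erase_insert A k
    (fun T => ∑ j ∈ A \ T, (∏ i ∈ T, ‖z i‖ ^ 2) * (z j).im)
  rw [nsmul_eq_mul] at this
  push_cast at this
  rw [← this]
  refine Finset.sum_congr rfl fun i _ => ?_
  rw [Finset.mul_sum]
  refine Finset.sum_congr rfl fun T hT => ?_
  have hiT : i ∉ T := fun h => Finset.notMem_erase i A ((Finset.mem_powersetCard.1 hT).1 h)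
  have hs : A.erase i \ T = A \ insert i T := by
    ext j; simp only [Finset.mem_sdiff, Finset.mem_erase, Finset.mem_insert]; tauto
  rw [hs, Finset.prod_insert hiT, Finset.mul_sum]
  exact Finset.sum_congr rfl fun j _ => by ring

theorem im_mul_mul_conj_add (z a b : ℂ) :
    (z * a * (starRingEnd ℂ) (a + z * b)).im =
      z.im * ‖a‖ ^ 2 + ‖z‖ ^ 2 * (a * (starRingEnd ℂ) b).im := by
  rw [Complex.sq_norm, Complex.sq_norm, Complex.normSq_apply, Complex.normSq_apply]
  simp only [Complex.mul_im, Complex.mul_re, Complex.add_re, Complex.add_im, Complex.conj_re,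
    Complex.conj_im]
  ring

/-- Quantitative form of the fact that `e_{k+1} / e_k` maps the upper half-plane to itself.
Expanding `(k + 2) e_{k+2} = ∑ z_i e_{k+1}(A \ i)` and `e_{k+1} = e_{k+1}(A \ i) + z_i e_k(A \ i)`
gives nonnegative terms `Im z_i |e_{k+1}(A \ i)|²`, which are dropped, plus `|z_i|²` times the same
quantity one degree lower on `A \ i`. These reassemble to `imWeight` by induction. -/
theorem imWeight_le_im_esum_mul_conj (k : ℕ) (A : Finset ι) (z : ι → ℂ)
    (hz : ∀ i ∈ A, 0 ≤ (z i).im) :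
    imWeight A k z ≤
      (k + 1 : ℝ) * (esum A (k + 1) z * (starRingEnd ℂ) (esum A k z)).im := by
  induction k generalizing A with
  | zero => simp [imWeight, esum, Finset.powersetCard_one]
  | succ k ih =>
    have key : ((k + 1 : ℕ) + 1 : ℝ) *
        (esum A (k + 1 + 1) z * (starRingEnd ℂ) (esum A (k + 1) z)).im =
        ∑ i ∈ A, ((z i).im * ‖esum (A.erase i) (k + 1) z‖ ^ 2 + ‖z i‖ ^ 2 *
          (esum (A.erase i) (k + 1) z * (starRingEnd ℂ) (esum (A.erase i) k z)).im) := by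
      have h1 : (((k + 1 : ℕ) + 1 : ℝ) *
          (esum A (k + 1 + 1) z * (starRingEnd ℂ) (esum A (k + 1) z)).im) =
          ((((k + 1 + 1 : ℕ) : ℂ) * esum A (k + 1 + 1) z) *
            (starRingEnd ℂ) (esum A (k + 1) z)).im := by
        rw [mul_assoc, ← Complex.ofReal_natCast, Complex.im_ofReal_mul]; push_cast; rfl
      rw [h1, ← sum_mul_esum_erase, Finset.sum_mul, Complex.im_sum]
      refine Finset.sum_congr rfl fun i hi => ?_
      rw [← im_mul_mul_conj_add, ← esum_succ_eq_erase hi]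
    rw [key]
    have h2 : (k + 1 : ℝ) * imWeight A (k + 1) z ≤ (k + 1 : ℝ) * ∑ i ∈ A, ‖z i‖ ^ 2 *
          (esum (A.erase i) (k + 1) z * (starRingEnd ℂ) (esum (A.erase i) k z)).im := by
      rw [← sum_mul_imWeight_erase, Finset.mul_sum]
      refine Finset.sum_le_sum fun i hi => ?_
      rw [mul_left_comm]
      exact mul_le_mul_of_nonneg_left
        (ih (A.erase i) fun j hj => hz j (Finset.mem_of_mem_erase hj)) (by positivity)
    refine (le_of_mul_le_mul_left h2 (by positivity)).trans (Finset.sum_le_sum fun i hi => ?_)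
    have := mul_nonneg (hz i hi) (sq_nonneg ‖esum (A.erase i) (k + 1) z‖)
    linarith

theorem abs_im_prod_le (W : Finset ι) (w : ι → ℂ) :
    |(∏ i ∈ W, w i).im| ≤ ∑ j ∈ W, |(w j).im| * ∏ i ∈ W.erase j, ‖w i‖ := by
  induction W using Finset.induction_on with
  | empty => simp
  | insert a W ha ih =>
    rw [Finset.prod_insert ha, Finset.sum_insert ha, Finset.erase_insert ha, Complex.mul_im,
      add_comm]
    refine (abs_add_le _ _).trans (add_le_add ?_ ?_)
    · rw [abs_mul, ← norm_prod]
      exact mul_le_mul_of_nonneg_left (Complex.abs_re_le_norm _) (abs_nonneg _)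
    · rw [abs_mul]
      refine (mul_le_mul (Complex.abs_re_le_norm _) ih (abs_nonneg _) (norm_nonneg _)).trans
        (le_of_eq ?_)
      rw [Finset.mul_sum]
      refine Finset.sum_congr rfl fun j hj => ?_
      have hja : a ≠ j := fun h => ha (h ▸ hj)
      rw [Finset.erase_insert_of_ne hja, Finset.prod_insert fun h => ha (Finset.mem_of_mem_erase h)]
      ring

theorem imWeight_nonneg (A : Finset ι) (k : ℕ) (z : ι → ℂ) (hz : ∀ i ∈ A, 0 ≤ (z i).im) :
    0 ≤ imWeight A k z :=
  Finset.sum_nonneg fun T _ => Finset.sum_nonneg fun j hj =>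
    mul_nonneg (by positivity) (hz j (Finset.mem_sdiff.1 hj).1)

theorem prod_mul_im_le_imWeight {A T : Finset ι} {k : ℕ} {z : ι → ℂ} {j : ι}
    (hz : ∀ i ∈ A, 0 ≤ (z i).im) (hT : T ⊆ A) (hc : T.card = k) (hj : j ∈ A) (hjT : j ∉ T) :
    (∏ i ∈ T, ‖z i‖ ^ 2) * (z j).im ≤ imWeight A k z := by
  unfold imWeight
  refine le_trans ?_ (Finset.single_le_sum (f := fun T =>
    ∑ j ∈ A \ T, (∏ i ∈ T, ‖z i‖ ^ 2) * (z j).im) (fun T _ => Finset.sum_nonneg fun j hj =>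
      mul_nonneg (by positivity) (hz j (Finset.mem_sdiff.1 hj).1))
      (Finset.mem_powersetCard.2 ⟨hT, hc⟩))
  exact Finset.single_le_sum (f := fun j => (∏ i ∈ T, ‖z i‖ ^ 2) * (z j).im) (fun j hj =>
      mul_nonneg (by positivity) (hz j (Finset.mem_sdiff.1 hj).1))
      (Finset.mem_sdiff.2 ⟨hj, hjT⟩)

/-- The common factors contribute `|z_U|²` with `U = S ∩ T`. The symmetric difference `W` has odd
size, so after picking the factor `j` that supplies an imaginary part, the rest splits into halves
`P`, `Q` of equal size. By AM-GM `|z_P| |z_Q|` is at most the mean of `|z_P|²` and `|z_Q|²`, and `U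
∪ P`, `U ∪ Q` are `k`-sets avoiding `j`, that is, terms of `imWeight`. There are at most `2 * k + 1`
choices of `j`. -/
theorem abs_im_prod_mul_conj_prod_le {A S T : Finset ι} {k : ℕ} {z : ι → ℂ}
    (hz : ∀ i ∈ A, 0 ≤ (z i).im) (hS : S ⊆ A) (hT : T ⊆ A) (hSc : S.card = k + 1)
    (hTc : T.card = k) :
    |((∏ i ∈ S, z i) * (starRingEnd ℂ) (∏ i ∈ T, z i)).im| ≤
      (2 * k + 1 : ℝ) * imWeight A k z := by
  set U := S ∩ T with hU
  set W := (S \ T) ∪ (T \ S) with hW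
  set w : ι → ℂ := fun i => if i ∈ S then z i else (starRingEnd ℂ) (z i) with hw
  have hdisj : Disjoint (S \ T) (T \ S) := by
    rw [Finset.disjoint_left]; intro i h1 h2
    exact (Finset.mem_sdiff.1 h1).2 (Finset.mem_sdiff.1 h2).1
  have hnorm : ∀ i, ‖w i‖ = ‖z i‖ := fun i => by
    by_cases h : i ∈ S <;> simp [hw, h]
  have himw : ∀ i, |(w i).im| = |(z i).im| := fun i => by
    by_cases h : i ∈ S <;> simp [hw, h]
  have hprod : (∏ i ∈ S, z i) * (starRingEnd ℂ) (∏ i ∈ T, z i) =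
      ((∏ i ∈ U, ‖z i‖ ^ 2 : ℝ) : ℂ) * ∏ i ∈ W, w i := by
    have h1 : ∏ i ∈ S, z i = (∏ i ∈ U, z i) * ∏ i ∈ S \ T, z i := by
      rw [hU, Finset.prod_inter_mul_prod_sdiff]
    have h2 : ∏ i ∈ T, z i = (∏ i ∈ U, z i) * ∏ i ∈ T \ S, z i := by
      rw [hU, Finset.inter_comm, Finset.prod_inter_mul_prod_sdiff]
    have h3 : ∏ i ∈ W, w i = (∏ i ∈ S \ T, z i) * (starRingEnd ℂ) (∏ i ∈ T \ S, z i) := by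
      rw [hW, Finset.prod_union hdisj, map_prod]
      congr 1
      · exact Finset.prod_congr rfl fun i hi => by simp [hw, (Finset.mem_sdiff.1 hi).1]
      · exact Finset.prod_congr rfl fun i hi => by simp [hw, (Finset.mem_sdiff.1 hi).2]
    have h4 : ((∏ i ∈ U, ‖z i‖ ^ 2 : ℝ) : ℂ) =
        (∏ i ∈ U, z i) * (starRingEnd ℂ) (∏ i ∈ U, z i) := by
      rw [map_prod, ← Finset.prod_mul_distrib, Complex.ofReal_prod]
      refine Finset.prod_congr rfl fun i _ => ?_
      rw [Complex.mul_conj, Complex.sq_norm]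
    rw [h1, h2, h3, h4, map_mul]
    ring
  have hUS : U.card + (S \ T).card = k + 1 := by
    rw [hU, Finset.card_inter_add_card_sdiff, hSc]
  have hUT : U.card + (T \ S).card = k := by
    rw [hU, Finset.inter_comm, Finset.card_inter_add_card_sdiff, hTc]
  have hWc : W.card = (S \ T).card + (T \ S).card := Finset.card_union_of_disjoint hdisj
  have hWA : W ⊆ A := Finset.union_subset (Finset.sdiff_subset.trans hS)
    (Finset.sdiff_subset.trans hT)
  have hUA : U ⊆ A := Finset.inter_subset_left.trans hS
  have hUW : Disjoint U W := by
    rw [Finset.disjoint_left]; intro i h1 h2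
    simp only [hU, hW, Finset.mem_inter, Finset.mem_union, Finset.mem_sdiff] at h1 h2
    tauto
  rw [hprod, Complex.im_ofReal_mul, abs_mul, abs_of_nonneg (by positivity)]
  have hterm : ∀ j ∈ W, (∏ i ∈ U, ‖z i‖ ^ 2) * (|(w j).im| * ∏ i ∈ W.erase j, ‖w i‖) ≤
      imWeight A k z := by
    intro j hj
    have hcard : (W.erase j).card = 2 * (T \ S).card := by
      rw [Finset.card_erase_of_mem hj]; omega
    obtain ⟨P, hP, hPc⟩ := Finset.exists_subset_card_eq
      (show (T \ S).card ≤ (W.erase j).card by omega)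
    have hQc : (W.erase j \ P).card = (T \ S).card := by
      rw [Finset.card_sdiff_of_subset hP]; omega
    have hjU : j ∉ U := fun h => (Finset.disjoint_left.1 hUW h) hj
    have hbound : ∀ R : Finset ι, R ⊆ W.erase j → R.card = (T \ S).card →
        (∏ i ∈ U, ‖z i‖ ^ 2) * (∏ i ∈ R, ‖z i‖) ^ 2 * (z j).im ≤ imWeight A k z := by
      intro R hR hRc
      have hd : Disjoint U R :=
        Finset.disjoint_of_subset_right (hR.trans (Finset.erase_subset _ _)) hUW
      rw [← Finset.prod_pow, ← Finset.prod_union hd]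
      refine prod_mul_im_le_imWeight hz (Finset.union_subset hUA
        ((hR.trans (Finset.erase_subset _ _)).trans hWA)) ?_ (hWA hj) ?_
      · rw [Finset.card_union_of_disjoint hd, hRc, hUT]
      · rw [Finset.mem_union, not_or]
        exact ⟨hjU, fun h => Finset.notMem_erase j W (hR h)⟩
    have b1 := hbound P hP hPc
    have b2 := hbound (W.erase j \ P) Finset.sdiff_subset hQc
    have hsplit : ∏ i ∈ W.erase j, ‖w i‖ = (∏ i ∈ P, ‖z i‖) * ∏ i ∈ W.erase j \ P, ‖z i‖ := by
      rw [Finset.prod_congr rfl fun i _ => hnorm i, mul_comm, Finset.prod_sdiff hP]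
    rw [hsplit, himw, abs_of_nonneg (hz j (hWA hj))]
    have hnn : 0 ≤ (∏ i ∈ U, ‖z i‖ ^ 2) * (z j).im :=
      mul_nonneg (by positivity) (hz j (hWA hj))
    nlinarith [mul_nonneg hnn (sq_nonneg ((∏ i ∈ P, ‖z i‖) - ∏ i ∈ W.erase j \ P, ‖z i‖))]
  calc (∏ i ∈ U, ‖z i‖ ^ 2) * |(∏ i ∈ W, w i).im|
      ≤ (∏ i ∈ U, ‖z i‖ ^ 2) * ∑ j ∈ W, |(w j).im| * ∏ i ∈ W.erase j, ‖w i‖ :=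
        mul_le_mul_of_nonneg_left (abs_im_prod_le W w) (by positivity)
    _ ≤ ∑ _j ∈ W, imWeight A k z := by
        rw [Finset.mul_sum]; exact Finset.sum_le_sum hterm
    _ = (W.card : ℝ) * imWeight A k z := by rw [Finset.sum_const, nsmul_eq_mul]
    _ ≤ _ := by
        refine mul_le_mul_of_nonneg_right ?_ (imWeight_nonneg A k z hz)
        have : W.card ≤ 2 * k + 1 := by omega
        exact_mod_cast this

/-- The elementary symmetric polynomial with its coefficients perturbed by `c`. -/
def perturbedEsum {R : Type*} [CommRing R] [Algebra ℝ R] (A : Finset ι) (k : ℕ)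
    (c : Finset ι → ℝ) (x : ι → R) : R :=
  ∑ T ∈ A.powersetCard k, algebraMap ℝ R (1 + c T) * ∏ i ∈ T, x i

/-- Small perturbations of elementary symmetric polynomials are stable. -/
theorem perturbedEsum_ne_zero {A : Finset ι} {k : ℕ} {c : Finset ι → ℝ} {ε : ℝ} {z : ι → ℂ}
    (hk : k + 1 ≤ A.card) (hε : 0 ≤ ε) (hc : ∀ T, |c T| ≤ ε)
    (hsmall : (k + 1) * ((2 * k + 1) * (2 ^ A.card * (2 ^ A.card * ε))) < 1)
    (hz : ∀ i ∈ A, 0 < (z i).im) : perturbedEsum A (k + 1) c z ≠ 0 := by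
  have hz' : ∀ i ∈ A, 0 ≤ (z i).im := fun i hi => (hz i hi).le
  have hpos : 0 < imWeight A k z := by
    obtain ⟨T, hT, hTc⟩ := Finset.exists_subset_card_eq (show k ≤ A.card by omega)
    obtain ⟨j, hj⟩ : (A \ T).Nonempty := by
      rw [← Finset.card_pos, Finset.card_sdiff_of_subset hT]; omega
    rw [Finset.mem_sdiff] at hj
    refine lt_of_lt_of_le ?_ (prod_mul_im_le_imWeight hz' hT hTc hj.1 hj.2)
    refine mul_pos (Finset.prod_pos fun i hi => ?_) (hz j hj.1)
    have : z i ≠ 0 := fun h => by have := hz i (hT hi); simp [h] at this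
    positivity
  -- Multiplying by the conjugate of the unperturbed `e_k` makes the imaginary part of the main term
  -- at least `imWeight / (k + 1)`, while that of the perturbation is a tiny multiple of the same
  -- `imWeight`; they cannot cancel.
  set g := (starRingEnd ℂ) (esum A k z) with hg
  have hcard : ∀ l, ((A.powersetCard l).card : ℝ) ≤ 2 ^ A.card := fun l => by
    have : (A.powersetCard l).card ≤ 2 ^ A.card := by
      rw [Finset.card_powersetCard]; exact Nat.choose_le_two_pow _ _
    exact_mod_cast this
  have hone : ∀ S ∈ A.powersetCard (k + 1), |((∏ i ∈ S, z i) * g).im| ≤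
      2 ^ A.card * ((2 * k + 1) * imWeight A k z) := by
    intro S hS
    rw [Finset.mem_powersetCard] at hS
    rw [hg, esum, map_sum, Finset.mul_sum, Complex.im_sum]
    refine (Finset.abs_sum_le_sum_abs _ _).trans ?_
    refine (Finset.sum_le_card_nsmul _ _ ((2 * k + 1) * imWeight A k z) fun T hT => ?_).trans ?_
    · rw [Finset.mem_powersetCard] at hT
      exact abs_im_prod_mul_conj_prod_le hz' hS.1 hT.1 hS.2 hT.2
    · rw [nsmul_eq_mul]
      exact mul_le_mul_of_nonneg_right (hcard k) (by positivity)
  have hsplit : perturbedEsum A (k + 1) c z = esum A (k + 1) z +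
      ∑ S ∈ A.powersetCard (k + 1), (c S : ℂ) * ∏ i ∈ S, z i := by
    rw [perturbedEsum, esum, ← Finset.sum_add_distrib]
    refine Finset.sum_congr rfl fun S _ => ?_
    simp only [Complex.coe_algebraMap]; push_cast; ring
  have hpert : |((∑ S ∈ A.powersetCard (k + 1), (c S : ℂ) * ∏ i ∈ S, z i) * g).im| ≤
      2 ^ A.card * (ε * (2 ^ A.card * ((2 * k + 1) * imWeight A k z))) := by
    rw [Finset.sum_mul, Complex.im_sum]
    refine (Finset.abs_sum_le_sum_abs _ _).trans ?_
    refine (Finset.sum_le_card_nsmul _ _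
      (ε * (2 ^ A.card * ((2 * k + 1) * imWeight A k z))) fun S hS => ?_).trans ?_
    · rw [mul_assoc, Complex.im_ofReal_mul, abs_mul]
      exact mul_le_mul (hc S) (hone S hS) (abs_nonneg _) hε
    · rw [nsmul_eq_mul]
      exact mul_le_mul_of_nonneg_right (hcard _) (by positivity)
  intro h0
  have hmain := imWeight_le_im_esum_mul_conj k A z hz'
  rw [← hg] at hmain
  have hsum : (esum A (k + 1) z * g).im +
      ((∑ S ∈ A.powersetCard (k + 1), (c S : ℂ) * ∏ i ∈ S, z i) * g).im = 0 := by
    rw [← Complex.add_im, ← add_mul, ← hsplit, h0]; simp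
  have hle : (esum A (k + 1) z * g).im ≤
      2 ^ A.card * (ε * (2 ^ A.card * ((2 * k + 1) * imWeight A k z))) := by
    have := neg_abs_le ((∑ S ∈ A.powersetCard (k + 1), (c S : ℂ) * ∏ i ∈ S, z i) * g).im
    linarith
  have h3 : imWeight A k z ≤
      ((k + 1) * ((2 * k + 1) * (2 ^ A.card * (2 ^ A.card * ε)))) * imWeight A k z := by
    refine hmain.trans ((mul_le_mul_of_nonneg_left hle (by positivity)).trans (le_of_eq ?_))
    ring
  nlinarith

end ElementarySymmetric

/-! ### From stability to hyperbolicity. -/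

section Hyperbolicity

theorem eval_lineRestriction {n : ℕ} (p : MvPolynomial (Fin n) ℝ)
    (e x : EuclideanSpace ℝ (Fin n)) (t : ℝ) :
    (lineRestriction p e x).eval t = MvPolynomial.aeval (fun i => e i * t + x i) p := by
  rw [lineRestriction, ← Polynomial.coe_aeval_eq_eval, ← AlgHom.comp_apply,
    MvPolynomial.comp_aeval]
  simp

theorem aeval_lineRestriction {n : ℕ} (p : MvPolynomial (Fin n) ℝ)
    (e x : EuclideanSpace ℝ (Fin n)) (z : ℂ) :
    Polynomial.aeval z (lineRestriction p e x) =
      MvPolynomial.aeval (fun i => (e i : ℂ) * z + (x i : ℂ)) p := by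
  rw [lineRestriction, ← AlgHom.comp_apply, MvPolynomial.comp_aeval]
  simp

/-- A homogeneous polynomial without zeros in the product of upper half-planes is hyperbolic in
every positive direction. -/
theorem isHyperbolic_of_stable {n d : ℕ} {p : MvPolynomial (Fin n) ℝ}
    {e : EuclideanSpace ℝ (Fin n)} (hp : p.IsHomogeneous d)
    (hst : ∀ z : Fin n → ℂ, (∀ i, 0 < (z i).im) → MvPolynomial.aeval z p ≠ 0)
    (he : ∀ i, 0 < e i) (hne : MvPolynomial.eval (fun i => e i) p ≠ 0) : IsHyperbolic d p e := by
  refine ⟨hp, hne, fun x => ?_⟩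
  have him : ∀ z : ℂ, 0 < z.im → Polynomial.aeval z (lineRestriction p e x) ≠ 0 := by
    intro z hz
    rw [aeval_lineRestriction]
    refine hst _ fun i => ?_
    simpa using mul_pos (he i) hz
  -- It suffices that every complex root is real; roots in the lower half-plane are conjugate to
  -- roots in the upper one.
  refine Polynomial.Splits.of_splits_map (algebraMap ℝ ℂ) (IsAlgClosed.splits _) fun z hz => ?_
  have hz0 : Polynomial.aeval z (lineRestriction p e x) = 0 := by
    have := (Polynomial.mem_roots'.1 hz).2
    rwa [Polynomial.IsRoot.def, Polynomial.eval_map_algebraMap] at this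
  rcases lt_trichotomy z.im 0 with h | h | h
  · refine absurd ?_ (him ((starRingEnd ℂ) z) (by simpa using h))
    rw [Polynomial.aeval_conj, hz0, map_zero]
  · exact ⟨z.re, by apply Complex.ext <;> simp [h]⟩
  · exact absurd hz0 (him z h)

end Hyperbolicity

/-! ### Positivity, Lipschitz bounds and test points for perturbed elementary symmetric polynomials.
-/

section PerturbedEsum

variable {ι : Type*}

theorem map_perturbedEsum {R S : Type*} [CommRing R] [Algebra ℝ R] [CommRing S]
    [Algebra ℝ S] (φ : R →ₐ[ℝ] S) (A : Finset ι) (k : ℕ) (c : Finset ι → ℝ) (x : ι → R) :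
    φ (perturbedEsum A k c x) = perturbedEsum A k c (fun i => φ (x i)) := by
  simp only [perturbedEsum, map_sum, map_mul, map_prod, AlgHom.commutes]

theorem isHomogeneous_perturbedEsum (A : Finset ι) (k : ℕ) (c : Finset ι → ℝ) :
    (perturbedEsum A k c (MvPolynomial.X : ι → MvPolynomial ι ℝ)).IsHomogeneous k := by
  refine MvPolynomial.IsHomogeneous.sum _ _ _ fun T hT => ?_
  have h1 := MvPolynomial.isHomogeneous_C ι (1 + c T)
  have h2 := MvPolynomial.IsHomogeneous.prod T (MvPolynomial.X : ι → MvPolynomial ι ℝ)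
    (fun _ => 1) fun i _ => MvPolynomial.isHomogeneous_X ℝ i
  have := h1.mul h2
  simpa [(Finset.mem_powersetCard.1 hT).2, MvPolynomial.algebraMap_eq] using this

theorem perturbedEsum_real (A : Finset ι) (k : ℕ) (c : Finset ι → ℝ) (x : ι → ℝ) :
    perturbedEsum A k c x = ∑ T ∈ A.powersetCard k, (1 + c T) * ∏ i ∈ T, x i := rfl

theorem perturbedEsum_zero (A : Finset ι) (k : ℕ) (x : ι → ℝ) :
    perturbedEsum A k (fun _ => 0) x = esum A k x := by
  simp [perturbedEsum_real, esum]

theorem perturbedEsum_pos {A : Finset ι} {k : ℕ} {c : Finset ι → ℝ} {x : ι → ℝ}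
    (hk : k ≤ A.card) (hc : ∀ T, |c T| < 1) (hx : ∀ i ∈ A, 0 < x i) :
    0 < perturbedEsum A k c x := by
  rw [perturbedEsum_real]
  refine Finset.sum_pos (fun T hT => mul_pos ?_ (Finset.prod_pos fun i hi =>
    hx i ((Finset.mem_powersetCard.1 hT).1 hi))) (Finset.powersetCard_nonempty.2 hk)
  linarith [(abs_lt.1 (hc T)).1]

theorem perturbedEsum_mono {A : Finset ι} {k : ℕ} {c : Finset ι → ℝ} {x y : ι → ℝ}
    (hc : ∀ T, |c T| < 1) (hx : ∀ i ∈ A, 0 ≤ x i) (hxy : ∀ i ∈ A, x i ≤ y i) :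
    perturbedEsum A k c x ≤ perturbedEsum A k c y := by
  rw [perturbedEsum_real, perturbedEsum_real]
  refine Finset.sum_le_sum fun T hT => mul_le_mul_of_nonneg_left ?_ ?_
  · have hTA := (Finset.mem_powersetCard.1 hT).1
    exact Finset.prod_le_prod (fun i hi => hx i (hTA hi)) fun i hi => hxy i (hTA hi)
  · linarith [(abs_lt.1 (hc T)).1]

theorem abs_prod_sub_prod_le_card_mul (T : Finset ι) {x y : ι → ℝ} {δ : ℝ}
    (hx : ∀ i, |x i| ≤ 1) (hy : ∀ i, |y i| ≤ 1) (hxy : ∀ i, |x i - y i| ≤ δ) :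
    |∏ i ∈ T, x i - ∏ i ∈ T, y i| ≤ T.card * δ := by
  classical
  induction T using Finset.induction_on with
  | empty => simp
  | insert a T ha ih =>
    rw [Finset.prod_insert ha, Finset.prod_insert ha, Finset.card_insert_of_notMem ha]
    have h1 : |∏ i ∈ T, y i| ≤ 1 := by
      rw [Finset.abs_prod]; exact Finset.prod_le_one (fun _ _ => abs_nonneg _) fun i _ => hy i
    have h2 : x a * ∏ i ∈ T, x i - y a * ∏ i ∈ T, y i =
      x a * (∏ i ∈ T, x i - ∏ i ∈ T, y i) + (x a - y a) * ∏ i ∈ T, y i := by ring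
    rw [h2]
    refine (abs_add_le _ _).trans ?_
    rw [abs_mul, abs_mul]
    have hδ : 0 ≤ δ := (abs_nonneg _).trans (hxy a)
    have h3 := mul_le_mul (hx a) ih (abs_nonneg _) zero_le_one
    have h4 := mul_le_mul (hxy a) h1 (abs_nonneg _) hδ
    push_cast
    linarith

theorem abs_perturbedEsum_sub_le (A : Finset ι) (k : ℕ) {c : Finset ι → ℝ} {x y : ι → ℝ} {δ : ℝ}
    (hc : ∀ T, |c T| < 1) (hx : ∀ i, |x i| ≤ 1) (hy : ∀ i, |y i| ≤ 1)
    (hδ : 0 ≤ δ) (hxy : ∀ i, |x i - y i| ≤ δ) :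
    |perturbedEsum A k c x - perturbedEsum A k c y| ≤ 2 ^ A.card * (2 * (A.card * δ)) := by
  rw [perturbedEsum_real, perturbedEsum_real, ← Finset.sum_sub_distrib]
  refine (Finset.abs_sum_le_sum_abs _ _).trans ?_
  refine (Finset.sum_le_card_nsmul _ _ (2 * (A.card * δ)) fun T hT => ?_).trans ?_
  · rw [← mul_sub, abs_mul]
    refine mul_le_mul ?_ ((abs_prod_sub_prod_le_card_mul T hx hy hxy).trans ?_) (abs_nonneg _)
      zero_le_two
    · refine (abs_add_le _ _).trans ?_
      rw [abs_one]; linarith [hc T]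
    · have := Finset.card_le_card (Finset.mem_powersetCard.1 hT).1
      exact mul_le_mul_of_nonneg_right (by exact_mod_cast this) hδ
  · rw [nsmul_eq_mul]
    refine mul_le_mul_of_nonneg_right ?_ (by positivity)
    have : (A.powersetCard k).card ≤ 2 ^ A.card := by
      rw [Finset.card_powersetCard]; exact Nat.choose_le_two_pow _ _
    exact_mod_cast this

variable [DecidableEq ι]

/-- Splitting off a variable whose monomials are unperturbed. -/
theorem perturbedEsum_succ_eq_erase {A : Finset ι} {o : ι} (ho : o ∈ A) {k : ℕ}
    {c : Finset ι → ℝ} (hc : ∀ T, o ∈ T → c T = 0) (x : ι → ℝ) :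
    perturbedEsum A (k + 1) c x =
      x o * esum (A.erase o) k x + perturbedEsum (A.erase o) (k + 1) c x := by
  rw [perturbedEsum_real, perturbedEsum_real, sum_powersetCard_succ_erase ho, add_comm, esum,
    Finset.mul_sum]
  congr 1
  refine Finset.sum_congr rfl fun T hT => ?_
  rw [hc _ (Finset.mem_insert_self _ _), Finset.prod_insert fun h =>
    Finset.notMem_erase o A ((Finset.mem_powersetCard.1 hT).1 h)]
  ring

theorem sum_powersetCard_mul_prod_ite {A S : Finset ι} (hS : S ⊆ A) (k : ℕ) (w : Finset ι → ℝ)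
    (a : ℝ) :
    ∑ T ∈ A.powersetCard k, w T * ∏ i ∈ T, (if i ∈ S then a else 0) =
      ∑ T ∈ S.powersetCard k, w T * a ^ k := by
  rw [← Finset.sum_subset (Finset.powersetCard_mono hS)]
  · refine Finset.sum_congr rfl fun T hT => ?_
    rw [Finset.mem_powersetCard] at hT
    rw [Finset.prod_congr rfl fun i hi => if_pos (hT.1 hi), Finset.prod_const, hT.2]
  · intro T hT hTS
    rw [Finset.mem_powersetCard] at hT hTS
    obtain ⟨i, hi, hiS⟩ := Finset.not_subset.1 fun h => hTS ⟨h, hT.2⟩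
    rw [Finset.prod_eq_zero hi (if_neg hiS), mul_zero]

/-- The point on the boundary of the unperturbed cone detecting the coefficient of `S`. -/
noncomputable def testVector (o : ι) (S : Finset ι) (a b : ℝ) (i : ι) : ℝ :=
  if i = o then -b else if i ∈ S then a else 0

/-- The `k + 1` monomials containing `o` contribute `-(a / (k + 1)) * (k + 1) * a ^ k`, which
cancels the unperturbed monomial of `S`; only the perturbation of its coefficient survives. -/
theorem perturbedEsum_testVector {A S : Finset ι} {o : ι} (ho : o ∈ A) (hS : S ⊆ A.erase o)
    {k : ℕ} (hSc : S.card = k + 1) {c : Finset ι → ℝ} (hc : ∀ T, o ∈ T → c T = 0) (a : ℝ) :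
    perturbedEsum A (k + 1) c (testVector o S a (a / (k + 1))) = c S * a ^ (k + 1) := by
  have hval : ∀ T ⊆ A.erase o, ∏ i ∈ T, testVector o S a (a / (k + 1)) i =
      ∏ i ∈ T, (if i ∈ S then a else 0) := fun T hT =>
    Finset.prod_congr rfl fun i hi => by
      rw [testVector, if_neg (Finset.ne_of_mem_erase (hT hi))]
  have h1 : esum (A.erase o) k (testVector o S a (a / (k + 1))) = (k + 1) * a ^ k := by
    have := sum_powersetCard_mul_prod_ite hS k (fun _ => 1) a
    simp only [one_mul, Finset.sum_const, Finset.card_powersetCard, hSc, nsmul_eq_mul,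
      Nat.choose_succ_self_right] at this
    rw [esum, Finset.sum_congr rfl fun T hT => hval T (Finset.mem_powersetCard.1 hT).1, this]
    push_cast; ring
  have h2 : perturbedEsum (A.erase o) (k + 1) c (testVector o S a (a / (k + 1))) =
      (1 + c S) * a ^ (k + 1) := by
    have := sum_powersetCard_mul_prod_ite hS (k + 1) (fun T => 1 + c T) a
    rw [← hSc, Finset.powersetCard_self, Finset.sum_singleton, hSc] at this
    rw [perturbedEsum_real, Finset.sum_congr rfl fun T hT => by
      rw [hval T (Finset.mem_powersetCard.1 hT).1], this]
  rw [perturbedEsum_succ_eq_erase ho hc, h1, h2, testVector, if_pos rfl]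
  have : (k + 1 : ℝ) ≠ 0 := by positivity
  field_simp
  ring

/-- Positivity propagates from a point with small, mostly nonnegative coordinates along the
direction that is `1 / 2` at `o` and `r` elsewhere. -/
theorem perturbedEsum_add_smul_pos {A : Finset ι} {o : ι} (ho : o ∈ A) {k : ℕ}
    (hk : k + 2 ≤ A.card) {c : Finset ι → ℝ} (hc0 : ∀ T, o ∈ T → c T = 0)
    (hc : ∀ T, |c T| < 1) {y u : ι → ℝ} {r t : ℝ} (hr : 0 < r) (hr1 : r ≤ 1 / 2)
    (hy : ∀ i, i ≠ o → 0 ≤ y i) (hy1 : ∀ i, |y i| ≤ 1 / 2)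
    (hg : 2 ^ A.card * (2 * (A.card * r)) ≤ esum (A.erase o) k y)
    (hpos : 0 < perturbedEsum A (k + 1) c y) (ht : 0 < t)
    (hu : ∀ i, i ≠ o → u i = r * t + y i) (huo : u o = 1 / 2 * t + y o) :
    0 < perturbedEsum A (k + 1) c u := by
  rw [perturbedEsum_succ_eq_erase ho hc0] at hpos ⊢
  have hcard : (A.erase o).card + 1 = A.card := Finset.card_erase_add_one ho
  have hrt : 0 < r * t := mul_pos hr ht
  have hupos : ∀ i ∈ A.erase o, 0 < u i := fun i hi => by
    rw [hu i (Finset.ne_of_mem_erase hi)]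
    linarith [hy i (Finset.ne_of_mem_erase hi)]
  rcases le_or_gt 0 (u o) with h | h
  · have h1 : 0 < esum (A.erase o) k u := by
      rw [← perturbedEsum_zero]
      exact perturbedEsum_pos (by omega) (by simp) hupos
    have h2 : 0 < perturbedEsum (A.erase o) (k + 1) c u :=
      perturbedEsum_pos (by omega) hc hupos
    have := mul_nonneg h h1.le
    linarith
  -- Write the polynomial as `x_o * g + h`. While `u o < 0`, `t` is at most `1`, `h` has not
  -- decreased and `g` has grown by at most `L * t`. Since `u o ≥ -1/2`, that growth costs at most
  -- `L * t / 2`, which the gain `t / 2 * g(y)` from raising the coordinate at `o` covers because `L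
  -- ≤ g(y)`.
  · have hyo := abs_le.1 (hy1 o)
    have ht1 : t ≤ 1 := by linarith
    have hmono : perturbedEsum (A.erase o) (k + 1) c y ≤ perturbedEsum (A.erase o) (k + 1) c u :=
      perturbedEsum_mono hc (fun i hi => hy i (Finset.ne_of_mem_erase hi)) fun i hi => by
        rw [hu i (Finset.ne_of_mem_erase hi)]; linarith
    have hlip : esum (A.erase o) k u - esum (A.erase o) k y ≤
        2 ^ A.card * (2 * (A.card * (r * t))) := by
      -- The Lipschitz bound wants every coordinate to move by at most `r * t`, but the one at `o`
      -- moves by `t / 2`; as `g` does not involve `o`, that coordinate can be reset.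
      have hagree : esum (A.erase o) k (Function.update u o (y o)) = esum (A.erase o) k u := by
        refine Finset.sum_congr rfl fun T hT => Finset.prod_congr rfl fun i hi => ?_
        exact Function.update_of_ne
          (Finset.ne_of_mem_erase ((Finset.mem_powersetCard.1 hT).1 hi)) _ _
      have := abs_perturbedEsum_sub_le (A.erase o) k (c := fun _ => 0)
        (x := Function.update u o (y o)) (y := y) (δ := r * t) (by simp)
        (fun i => by
          by_cases hi : i = o
          · subst hi; simp only [Function.update_self]; linarith [hy1 i]
          · rw [Function.update_of_ne hi, hu i hi, abs_of_nonneg (by linarith [hy i hi])]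
            have := (abs_le.1 (hy1 i)).2
            nlinarith) (fun i => (hy1 i).trans (by norm_num)) hrt.le
        (fun i => by
          by_cases hi : i = o
          · subst hi; simpa using hrt.le
          · rw [Function.update_of_ne hi, hu i hi, add_sub_cancel_right, abs_of_pos hrt])
      rw [perturbedEsum_zero, perturbedEsum_zero, hagree] at this
      refine (le_abs_self _).trans (this.trans ?_)
      have hle : (A.erase o).card ≤ A.card := by omega
      have hle' : ((A.erase o).card : ℝ) ≤ A.card := by exact_mod_cast hle
      have h2 : (2 : ℝ) ^ (A.erase o).card ≤ 2 ^ A.card :=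
        pow_le_pow_right₀ (by norm_num) hle
      gcongr
    set L : ℝ := 2 ^ A.card * (2 * (A.card * r)) with hL
    have hLt : 2 ^ A.card * (2 * (A.card * (r * t))) = L * t := by rw [hL]; ring
    rw [hLt] at hlip
    have h1 : u o * esum (A.erase o) k u ≥ u o * (esum (A.erase o) k y + L * t) := by
      nlinarith
    have h2 : u o * (esum (A.erase o) k y + L * t) - y o * esum (A.erase o) k y =
        1 / 2 * t * esum (A.erase o) k y + u o * L * t := by rw [huo]; ring
    have hL0 : 0 ≤ L := by rw [hL]; positivity
    have h3 : 0 ≤ 1 / 2 * t * esum (A.erase o) k y + u o * L * t := by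
      have : -(1 / 2) ≤ u o := by linarith
      nlinarith [mul_nonneg hL0 ht.le]
    linarith

end PerturbedEsum

/-! ### The family of hyperbolic polynomials and its test balls. -/

section TestFamily

theorem mem_hyperbolicityCone_of_forall_pos {n : ℕ} {p : MvPolynomial (Fin n) ℝ}
    {e y : EuclideanSpace ℝ (Fin n)}
    (h : ∀ t : ℝ, 0 < t → MvPolynomial.aeval (fun i => e i * t + y i) p ≠ (0 : ℝ)) :
    y ∈ hyperbolicityCone p e := by
  intro t ht
  by_contra! hpos
  exact h t hpos (by rw [← eval_lineRestriction]; exact ht)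

/-- A sign change along the ray forces a root in `[0, t]`, and it is not `0`. -/
theorem notMem_hyperbolicityCone_of_neg_of_pos {n : ℕ} {p : MvPolynomial (Fin n) ℝ}
    {e y : EuclideanSpace ℝ (Fin n)} {t : ℝ} (ht : 0 < t)
    (hneg : MvPolynomial.aeval (fun i => y i) p < (0 : ℝ))
    (hpos : (0 : ℝ) < MvPolynomial.aeval (fun i => e i * t + y i) p) :
    y ∉ hyperbolicityCone p e := by
  intro hy
  have h0 : (lineRestriction p e y).eval 0 < 0 := by
    rw [eval_lineRestriction]; simpa using hneg
  have h1 : 0 < (lineRestriction p e y).eval t := by rwa [eval_lineRestriction]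
  obtain ⟨s, hs, hs0⟩ := intermediate_value_Icc ht.le
    (Polynomial.continuous (lineRestriction p e y)).continuousOn ⟨h0.le, h1.le⟩
  have := hy s hs0
  have hs' : s = 0 := le_antisymm this hs.1
  simp only [hs'] at hs0
  linarith

theorem abs_sub_apply_le_of_mem_closedBall {n : ℕ} {x y : EuclideanSpace ℝ (Fin n)} {r : ℝ}
    (h : y ∈ Metric.closedBall x r) (i : Fin n) : |y i - x i| ≤ r := by
  rw [Metric.mem_closedBall, dist_eq_norm] at h
  have := PiLp.norm_apply_le (y - x) i
  rw [PiLp.sub_apply, Real.norm_eq_abs] at this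
  exact this.trans h

/-- The constants satisfy `7 / 16 + (3 / 4) ^ 2 = 1`. -/
theorem norm_le_one_of_coord_bounds {n : ℕ} {y : EuclideanSpace ℝ (Fin n)} {b : ℝ} (o : Fin n)
    (hb : n * b ^ 2 ≤ 7 / 16) (hy : ∀ i, i ≠ o → |y i| ≤ b) (hyo : |y o| ≤ 3 / 4) : ‖y‖ ≤ 1 := by
  rw [← sq_le_one_iff₀ (norm_nonneg _), EuclideanSpace.norm_sq_eq,
    ← Finset.add_sum_erase _ _ (Finset.mem_univ o)]
  have h1 : ∑ i ∈ Finset.univ.erase o, ‖y i‖ ^ 2 ≤ n * b ^ 2 := by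
    refine (Finset.sum_le_card_nsmul _ _ (b ^ 2) fun i hi => ?_).trans ?_
    · exact pow_le_pow_left₀ (norm_nonneg _) (hy i (Finset.ne_of_mem_erase hi)) 2
    · rw [nsmul_eq_mul]
      refine mul_le_mul_of_nonneg_right ?_ (sq_nonneg b)
      have : (Finset.univ.erase o).card ≤ n := (Finset.card_le_univ _).trans (by simp)
      exact_mod_cast this
  have h2 : ‖y o‖ ^ 2 ≤ (3 / 4) ^ 2 := pow_le_pow_left₀ (norm_nonneg _) hyo 2
  linarith

/-- There are `(n - 1).choose D` balls in the unit ball such that each pattern of inclusion in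
and disjointness from a hyperbolicity cone is realized. -/
theorem exists_hyperbolic_test_family {n D d : ℕ} (hn : 4 ≤ n) (hD : 1 ≤ D) (hDn : D + 1 ≤ n)
    (hDd : D ≤ d) :
    ∃ (Λ : Finset (Finset (Fin n))) (e : EuclideanSpace ℝ (Fin n))
      (x : Finset (Fin n) → EuclideanSpace ℝ (Fin n)),
      Λ.card = (n - 1).choose D ∧
      Metric.closedBall e ((1 / 2 ^ n) ^ (D + 8)) ⊆ Metric.closedBall 0 1 ∧
      (∀ S ∈ Λ, Metric.closedBall (x S) ((1 / 2 ^ n) ^ (D + 8)) ⊆ Metric.closedBall 0 1) ∧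
      ∀ s : Set (Finset (Fin n)), ∃ p : MvPolynomial (Fin n) ℝ, IsHyperbolic d p e ∧
        Metric.closedBall e ((1 / 2 ^ n) ^ (D + 8)) ⊆ hyperbolicityCone p e ∧
        ∀ S ∈ Λ,
          (S ∈ s → Metric.closedBall (x S) ((1 / 2 ^ n) ^ (D + 8)) ⊆ hyperbolicityCone p e) ∧
          (S ∉ s →
            Disjoint (Metric.closedBall (x S) ((1 / 2 ^ n) ^ (D + 8))) (hyperbolicityCone p e)) := by
  classical
  obtain ⟨k, rfl⟩ : ∃ k, D = k + 1 := ⟨D - 1, by omega⟩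
  set a : ℝ := 1 / 2 ^ n with ha
  have ha0 : 0 < a := by positivity
  have h2n : (2 : ℝ) ^ n = 1 / a := by rw [ha]; simp
  have hna : n * a ≤ 1 / 4 := by
    have h4 : 4 * n ≤ 2 ^ n := by
      clear * - hn
      induction n, hn using Nat.le_induction with
      | base => norm_num
      | succ m hm ih => rw [pow_succ]; omega
    have : (4 : ℝ) * n ≤ 2 ^ n := by exact_mod_cast h4
    rw [ha, mul_one_div, div_le_div_iff₀ (by positivity) (by norm_num)]
    linarith
  have hn4 : (4 : ℝ) ≤ n := by exact_mod_cast hn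
  have ha16 : a ≤ 1 / 16 := by nlinarith
  -- Points of a test ball are within `3 * r` of the test vector in each coordinate, so the
  -- polynomial moves by at most `2 ^ n * (2 * (n * (3 * r)))`, at most `3 / 2 * a ^ (k + 7)`. This
  -- is below the value `a ^ (k + 6)` taken in modulus at the test vector.
  set r : ℝ := a ^ (k + 1 + 8) with hr
  have hr0 : 0 < r := by positivity
  have hra : r ≤ a ^ (k + 7) * (1 / 16) ^ 2 := by
    rw [hr, show k + 1 + 8 = k + 7 + 2 by ring, pow_add]
    exact mul_le_mul_of_nonneg_left (pow_le_pow_left₀ ha0.le ha16 2) (by positivity)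
  have hak : ∀ m, a ^ m ≤ 1 := fun m => pow_le_one₀ ha0.le (by linarith)
  have hra' : r ≤ a * (1 / 256) := by
    refine hra.trans ?_
    have : a ^ (k + 7) ≤ a := by
      rw [show k + 7 = (k + 6) + 1 by ring, pow_succ]
      exact mul_le_of_le_one_left ha0.le (hak _)
    nlinarith
  have hnr : 2 ^ n * (n * r) ≤ a ^ (k + 7) * (1 / 4) := by
    have : 2 ^ n * (n * r) = a ^ (k + 7) * (n * a) := by
      rw [hr, h2n, show k + 1 + 8 = k + 7 + 2 by ring, pow_add]; field_simp
    rw [this]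
    exact mul_le_mul_of_nonneg_left hna (by positivity)
  let o : Fin n := ⟨0, by omega⟩
  let i₁ : Fin n := ⟨1, by omega⟩
  have hi₁ : i₁ ≠ o := by simp [i₁, o]
  have ho : o ∈ (Finset.univ : Finset (Fin n)) := Finset.mem_univ _
  have hcardn : (Finset.univ : Finset (Fin n)).card = n := by simp
  -- The direction is nearly the `o`-axis, as `perturbedEsum_add_smul_pos` requires, yet the ball of
  -- radius `r` around it stays in the nonnegative orthant.
  set e : EuclideanSpace ℝ (Fin n) := WithLp.toLp 2 fun i => if i = o then 1 / 2 else r with he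
  have heo : e o = 1 / 2 := by simp [he]
  have hei : ∀ i, i ≠ o → e i = r := fun i hi => by simp [he, hi]
  have hepos : ∀ i, 0 < e i := fun i => by
    by_cases hi : i = o
    · rw [hi, heo]; norm_num
    · rw [hei i hi]; exact hr0
  set v : Finset (Fin n) → Fin n → ℝ := fun S => testVector o S a (a / (k + 1)) with hv
  -- The shift by `2 * r` keeps all coordinates other than `o` at least `r` throughout the ball.
  set x : Finset (Fin n) → EuclideanSpace ℝ (Fin n) := fun S =>
    WithLp.toLp 2 fun i => v S i + if i = o then 0 else 2 * r with hx
  have hxo : ∀ S, x S o = v S o := fun S => by simp [hx]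
  have hxi : ∀ S i, i ≠ o → x S i = v S i + 2 * r := fun S i hi => by simp [hx, hi]
  have hvo : ∀ S, v S o = -(a / (k + 1)) := fun S => by simp [hv, testVector]
  have hvi : ∀ S i, i ≠ o → v S i = if i ∈ S then a else 0 := fun S i hi => by
    simp [hv, testVector, hi]
  have hvi0 : ∀ S i, i ≠ o → 0 ≤ v S i ∧ v S i ≤ a := fun S i hi => by
    rw [hvi S i hi]; split_ifs <;> exact ⟨by linarith, by linarith⟩
  have hak1 : 0 ≤ a / (k + 1) ∧ a / (k + 1) ≤ a :=
    ⟨by positivity, div_le_self ha0.le (by linarith [(Nat.cast_nonneg k : (0 : ℝ) ≤ k)])⟩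
  have hva : ∀ S i, |v S i| ≤ a := fun S i => by
    by_cases hi : i = o
    · rw [hi, hvo, abs_neg, abs_of_nonneg hak1.1]; exact hak1.2
    · rw [abs_of_nonneg (hvi0 S i hi).1]; exact (hvi0 S i hi).2
  have hyv : ∀ S, ∀ y ∈ Metric.closedBall (x S) r, ∀ i, |y i - v S i| ≤ 3 * r := by
    intro S y hy i
    have h := abs_le.1 (abs_sub_apply_le_of_mem_closedBall hy i)
    rw [abs_le]
    by_cases hi : i = o
    · rw [hi] at h ⊢; rw [hxo] at h; constructor <;> linarith
    · rw [hxi S i hi] at h; constructor <;> linarith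
  have hyr : ∀ S, ∀ y ∈ Metric.closedBall (x S) r, ∀ i, i ≠ o → v S i + r ≤ y i := by
    intro S y hy i hi
    have h := abs_le.1 (abs_sub_apply_le_of_mem_closedBall hy i)
    rw [hxi S i hi] at h
    linarith
  have hyabs : ∀ S, ∀ y ∈ Metric.closedBall (x S) r, ∀ i, |y i| ≤ 2 * a := by
    intro S y hy i
    have h1 := abs_le.1 (hyv S y hy i)
    have h2 := abs_le.1 (hva S i)
    rw [abs_le]; constructor <;> linarith
  have hb : n * (2 * a) ^ 2 ≤ 7 / 16 := by nlinarith
  refine ⟨(Finset.univ.erase o).powersetCard (k + 1), e, x, ?_, ?_, ?_, ?_⟩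
  · rw [Finset.card_powersetCard, Finset.card_erase_of_mem ho, hcardn]
  · intro y hy
    rw [mem_closedBall_zero_iff]
    refine norm_le_one_of_coord_bounds o hb (fun i hi => ?_) ?_
    · have h := abs_le.1 (abs_sub_apply_le_of_mem_closedBall hy i)
      rw [hei i hi] at h
      rw [abs_le]; constructor <;> linarith
    · have h := abs_le.1 (abs_sub_apply_le_of_mem_closedBall hy o)
      rw [heo] at h
      rw [abs_le]; constructor <;> linarith
  · intro S _ y hy
    rw [mem_closedBall_zero_iff]
    refine norm_le_one_of_coord_bounds o hb (fun i _ => hyabs S y hy i)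
      ((hyabs S y hy o).trans (by linarith))
  intro s
  -- Stability loses a factor `2 ^ n * 2 ^ n = a ^ (-2)` and a polynomial in `n`; size `a ^ 5`
  -- leaves `a ^ 3`, which beats that polynomial.
  set c : Finset (Fin n) → ℝ := fun T => if o ∈ T then 0 else if T ∈ s then a ^ 5 else -a ^ 5
    with hc
  have hc0 : ∀ T, o ∈ T → c T = 0 := fun T hT => by simp [hc, hT]
  have hcε : ∀ T, |c T| ≤ a ^ 5 := fun T => by
    have : 0 < a ^ 5 := by positivity
    simp only [hc]; split_ifs <;> simp [abs_of_pos, this, this.le]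
  have ha5 : a ^ 5 < 1 := pow_lt_one₀ ha0.le (by linarith) (by norm_num)
  have hc1 : ∀ T, |c T| < 1 := fun T => (hcε T).trans_lt ha5
  -- The power of `X i₁` only adjusts the degree: coordinate `i₁` is positive on the test balls, so
  -- signs there are unaffected.
  set p : MvPolynomial (Fin n) ℝ :=
    perturbedEsum Finset.univ (k + 1) c MvPolynomial.X * MvPolynomial.X i₁ ^ (d - (k + 1)) with hp
  have hpeval : ∀ u : Fin n → ℝ, MvPolynomial.aeval u p =
      perturbedEsum Finset.univ (k + 1) c u * u i₁ ^ (d - (k + 1)) := fun u => by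
    rw [hp, map_mul, map_perturbedEsum, map_pow]; simp
  have hpevalC : ∀ u : Fin n → ℂ, MvPolynomial.aeval u p =
      perturbedEsum Finset.univ (k + 1) c u * u i₁ ^ (d - (k + 1)) := fun u => by
    rw [hp, map_mul, map_perturbedEsum, map_pow]; simp
  have hppos : ∀ u : Fin n → ℝ, (∀ i, 0 < u i) → 0 < MvPolynomial.aeval u p := fun u hu => by
    rw [hpeval]
    exact mul_pos (perturbedEsum_pos (by omega) hc1 fun i _ => hu i) (pow_pos (hu _) _)
  have hlip : ∀ S, ∀ y ∈ Metric.closedBall (x S) r,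
      |perturbedEsum Finset.univ (k + 1) c (fun i => y i) -
        perturbedEsum Finset.univ (k + 1) c (v S)| < a ^ 5 * a ^ (k + 1) := by
    intro S y hy
    refine (abs_perturbedEsum_sub_le Finset.univ (k + 1) hc1
      (fun i => (hyabs S y hy i).trans (by linarith)) (fun i => (hva S i).trans (by linarith))
      (by positivity) (hyv S y hy)).trans_lt ?_
    rw [hcardn]
    have h7 : a ^ (k + 7) = a ^ 5 * a ^ (k + 1) * a := by ring
    have : 0 < a ^ 5 * a ^ (k + 1) := by positivity
    nlinarith
  refine ⟨p, isHyperbolic_of_stable ?_ ?_ hepos ?_, ?_, fun S hS => ?_⟩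
  · have := (isHomogeneous_perturbedEsum Finset.univ (k + 1) c).mul
      ((MvPolynomial.isHomogeneous_X ℝ i₁).pow (d - (k + 1)))
    rwa [one_mul, Nat.add_sub_cancel' hDd] at this
  · intro z hz
    rw [hpevalC]
    refine mul_ne_zero (perturbedEsum_ne_zero (ε := a ^ 5) (by omega) (by positivity) hcε ?_
      fun i _ => hz i) (pow_ne_zero _ fun h => by have := hz i₁; simp [h] at this)
    rw [hcardn, h2n]
    have hk : (k : ℝ) + 1 ≤ n := by exact_mod_cast (by omega : k + 1 ≤ n)
    have hk0 : (0 : ℝ) ≤ k := Nat.cast_nonneg k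
    have h1 : (1 / a) * ((1 / a) * a ^ 5) = a ^ 3 := by field_simp
    rw [h1]
    have h2 : ((k : ℝ) + 1) * ((2 * k + 1) * a ^ 3) ≤ n * ((2 * n) * a ^ 3) := by
      gcongr; linarith
    have h3 : (n : ℝ) * ((2 * n) * a ^ 3) = 2 * (n * a) ^ 2 * a := by ring
    have h4 : ((n : ℝ) * a) ^ 2 ≤ (1 / 4) ^ 2 := pow_le_pow_left₀ (by positivity) hna 2
    nlinarith
  · have := hppos (fun i => e i) hepos
    rw [MvPolynomial.aeval_eq_eval] at this
    exact this.ne'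
  · intro y hy
    refine mem_hyperbolicityCone_of_forall_pos fun t ht => (hppos _ fun i => ?_).ne'
    have h := abs_le.1 (abs_sub_apply_le_of_mem_closedBall hy i)
    have := mul_pos (hepos i) ht
    by_cases hi : i = o
    · have h' : e i = 1 / 2 := by rw [hi, heo]
      linarith
    · have h' := hei i hi
      linarith
  · rw [Finset.mem_powersetCard] at hS
    have hoS : o ∉ S := fun h => Finset.notMem_erase o _ (hS.1 h)
    have hFv : perturbedEsum Finset.univ (k + 1) c (v S) = c S * a ^ (k + 1) :=
      perturbedEsum_testVector ho hS.1 hS.2 hc0 a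
    constructor
    · intro hs y hy
      have hF : 0 < perturbedEsum Finset.univ (k + 1) c (fun i => y i) := by
        have h := abs_lt.1 (hlip S y hy)
        rw [hFv, show c S = a ^ 5 by simp [hc, hoS, hs]] at h
        linarith
      have hy0 : ∀ i, i ≠ o → 0 ≤ y i := fun i hi => by
        linarith [hyr S y hy i hi, (hvi0 S i hi).1]
      refine mem_hyperbolicityCone_of_forall_pos fun t ht => ?_
      rw [hpeval]
      refine mul_ne_zero (ne_of_gt ?_) (pow_ne_zero _ (ne_of_gt ?_))
      · refine perturbedEsum_add_smul_pos ho (by omega) hc0 hc1 hr0 (by linarith)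
          hy0 (fun i => (hyabs S y hy i).trans (by linarith)) ?_ hF ht (fun i hi => by rw [hei i hi])
          (by rw [heo])
        rw [hcardn]
        obtain ⟨i, hi⟩ : S.Nonempty := by rw [← Finset.card_pos, hS.2]; omega
        have hle : a ^ k ≤ esum (Finset.univ.erase o) k (fun i => y i) := by
          have hsub : S.erase i ⊆ Finset.univ.erase o := (Finset.erase_subset _ _).trans hS.1
          have hcd : (S.erase i).card = k := by
            rw [Finset.card_erase_of_mem hi, hS.2]; rfl
          have h1 : ∏ j ∈ S.erase i, y j ≤ esum (Finset.univ.erase o) k (fun i => y i) :=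
            Finset.single_le_sum (f := fun T => ∏ j ∈ T, y j) (fun T hT =>
              Finset.prod_nonneg fun j hj => hy0 j (Finset.ne_of_mem_erase
                ((Finset.mem_powersetCard.1 hT).1 hj))) (Finset.mem_powersetCard.2 ⟨hsub, hcd⟩)
          refine le_trans ?_ h1
          rw [← hcd, ← Finset.prod_const]
          refine Finset.prod_le_prod (fun _ _ => ha0.le) fun j hj => ?_
          have hjo := Finset.ne_of_mem_erase (hsub hj)
          have := hyr S y hy j hjo
          rw [hvi S j hjo, if_pos (Finset.mem_of_mem_erase hj)] at this
          linarith
        refine le_trans ?_ hle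
        have h7 : a ^ (k + 7) ≤ a ^ k := pow_le_pow_of_le_one ha0.le (by linarith) (by omega)
        have : 0 < a ^ k := by positivity
        linarith
      · linarith [mul_pos (hepos i₁) ht, hyr S y hy i₁ hi₁, (hvi0 S i₁ hi₁).1]
    · intro hs
      rw [Set.disjoint_left]
      intro y hy
      have hF : perturbedEsum Finset.univ (k + 1) c (fun i => y i) < 0 := by
        have h := abs_lt.1 (hlip S y hy)
        rw [hFv, show c S = -a ^ 5 by simp [hc, hoS, hs]] at h
        linarith
      -- At `t = 2` the coordinate at `o` is `1 + y o > 0`, so the point lies in the positive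
      -- orthant.
      refine notMem_hyperbolicityCone_of_neg_of_pos (t := 2) two_pos ?_ (hppos _ fun i => ?_)
      · rw [hpeval]
        refine mul_neg_of_neg_of_pos hF (pow_pos ?_ _)
        linarith [hyr S y hy i₁ hi₁, (hvi0 S i₁ hi₁).1]
      · by_cases hi : i = o
        · rw [hi, heo]
          linarith [(abs_le.1 (hyabs S y hy o)).1]
        · linarith [hepos i, hyr S y hy i hi, (hvi0 S i hi).1]

end TestFamily

/-! ### Geometry and normal form of spectrahedral cones. -/

section Spectrahedra

theorem isClosed_spectrahedralCone {n B : ℕ} (A : Fin n → Matrix (Fin B) (Fin B) ℝ) :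
    IsClosed (spectrahedralCone A) := by
  have h : spectrahedralCone A =
      {x | (∑ i, x i • A i).conjTranspose = ∑ i, x i • A i} ∩
        ⋂ v : Fin B → ℝ, {x | 0 ≤ star v ⬝ᵥ ((∑ i, x i • A i).mulVec v)} := by
    ext x
    simp only [spectrahedralCone, Set.mem_ofPred_eq, Matrix.posSemidef_iff_dotProduct_mulVec,
      Set.mem_inter_iff, Set.mem_iInter]
    rfl
  have hc : Continuous fun x : EuclideanSpace ℝ (Fin n) => ∑ i, x i • A i := by fun_prop
  rw [h]
  refine (isClosed_eq hc.matrix_conjTranspose hc).inter (isClosed_iInter fun v => ?_)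
  exact isClosed_le continuous_const
    (Continuous.dotProduct continuous_const (hc.matrix_mulVec continuous_const))

theorem sum_add_smul_matrix {n B : ℕ} (A : Fin n → Matrix (Fin B) (Fin B) ℝ)
    (x y : EuclideanSpace ℝ (Fin n)) (s : ℝ) :
    ∑ i, (x + s • y) i • A i = ∑ i, x i • A i + s • ∑ i, y i • A i := by
  rw [Finset.smul_sum, ← Finset.sum_add_distrib]
  refine Finset.sum_congr rfl fun i _ => ?_
  rw [PiLp.add_apply, PiLp.smul_apply, add_smul, smul_smul, smul_eq_mul]

theorem convex_spectrahedralCone {n B : ℕ} (A : Fin n → Matrix (Fin B) (Fin B) ℝ) :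
    Convex ℝ (spectrahedralCone A) := by
  intro x hx y hy a b ha hb _
  have h1 := sum_add_smul_matrix A (a • x) y b
  have h2 := sum_add_smul_matrix A 0 x a
  simp only [zero_add, PiLp.zero_apply, zero_smul, Finset.sum_const_zero] at h2
  change (∑ i, (a • x + b • y) i • A i).PosSemidef
  rw [h1, h2]
  exact (Matrix.PosSemidef.smul hx ha).add (Matrix.PosSemidef.smul hy hb)

theorem zero_mem_spectrahedralCone {n B : ℕ} (A : Fin n → Matrix (Fin B) (Fin B) ℝ) :
    (0 : EuclideanSpace ℝ (Fin n)) ∈ spectrahedralCone A := by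
  simpa [spectrahedralCone] using Matrix.PosSemidef.zero

/-- A closed convex set close to every point of a ball contains the ball of half the radius. -/
theorem closedBall_half_subset_of_infEDist_le {E : Type*} [NormedAddCommGroup E]
    [InnerProductSpace ℝ E] [CompleteSpace E] {K : Set E} (hne : K.Nonempty) (hcl : IsClosed K)
    (hcv : Convex ℝ K) {x : E} {r η : ℝ} (hr : 0 < r) (hη : η < r / 2)
    (h : ∀ y ∈ Metric.closedBall x r, Metric.infEDist y K ≤ ENNReal.ofReal η) :
    Metric.closedBall x (r / 2) ⊆ K := by
  intro z hz
  by_contra hzK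
  obtain ⟨w, hwK, hw⟩ := exists_norm_eq_iInf_of_complete_convex hne hcl.isComplete hcv z
  have hinner := (norm_eq_iInf_iff_real_inner_le_zero hcv hwK).1 hw
  have hzw : z - w ≠ 0 := fun h0 => hzK (by rwa [sub_eq_zero.1 h0])
  have hpos : 0 < ‖z - w‖ := norm_pos_iff.2 hzw
  set u : E := ‖z - w‖⁻¹ • (z - w) with hu
  have hu1 : ‖u‖ = 1 := by rw [hu, norm_smul, norm_inv, norm_norm, inv_mul_cancel₀ hpos.ne']
  -- Moving a missed point `z` by `r / 2` away from its projection `w` stays in the large ball, but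
  -- reaches distance at least `r / 2` from `K`, by the separating hyperplane at `w`.
  have hmem : z + (r / 2) • u ∈ Metric.closedBall x r := by
    rw [Metric.mem_closedBall, dist_eq_norm] at hz ⊢
    have : z + (r / 2) • u - x = (z - x) + (r / 2) • u := by abel
    rw [this]
    refine (norm_add_le _ _).trans ?_
    rw [norm_smul, hu1, Real.norm_eq_abs, abs_of_pos (by linarith)]
    linarith
  have hfar : ENNReal.ofReal (r / 2) ≤ Metric.infEDist (z + (r / 2) • u) K := by
    rw [Metric.le_infEDist]
    intro k hk
    rw [edist_dist]
    refine ENNReal.ofReal_le_ofReal ?_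
    rw [dist_eq_norm]
    have h1 : inner ℝ u (z + (r / 2) • u - k) ≤ ‖z + (r / 2) • u - k‖ := by
      simpa [hu1] using real_inner_le_norm u (z + (r / 2) • u - k)
    have h2 : z + (r / 2) • u - k = (z - w) + (r / 2) • u - (k - w) := by abel
    have h3 : inner ℝ u (z - w) = ‖z - w‖ := by
      rw [hu, real_inner_smul_left, real_inner_self_eq_norm_sq]; field_simp
    have h4 : inner ℝ u (k - w) ≤ 0 := by
      rw [hu, real_inner_smul_left]
      exact mul_nonpos_of_nonneg_of_nonpos (by positivity) (hinner k hk)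
    rw [h2, inner_sub_right, inner_add_right, h3, real_inner_smul_right,
      real_inner_self_eq_norm_sq, hu1, ← h2] at h1
    linarith
  have hle := hfar.trans (h _ hmem)
  rw [ENNReal.ofReal_le_ofReal_iff'] at hle
  rcases hle with hle | hle <;> linarith

theorem infEDist_le_of_hdist_le {n : ℕ} {K K' : Set (EuclideanSpace ℝ (Fin n))} {η : ℝ≥0∞}
    (h : hdist K K' ≤ η) {x : EuclideanSpace ℝ (Fin n)} (hx : x ∈ Metric.closedBall 0 1)
    (hxK : x ∈ K) : Metric.infEDist x K' ≤ η :=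
  (le_iSup₂_of_le (f := fun x (_ : x ∈ Metric.closedBall (0 : EuclideanSpace ℝ (Fin n)) 1 ∩ K) =>
    Metric.infEDist x K') x ⟨hx, hxK⟩ le_rfl).trans ((le_max_left _ _).trans h)

theorem infEDist_le_of_hdist_le' {n : ℕ} {K K' : Set (EuclideanSpace ℝ (Fin n))} {η : ℝ≥0∞}
    (h : hdist K K' ≤ η) {x : EuclideanSpace ℝ (Fin n)} (hx : x ∈ Metric.closedBall 0 1)
    (hxK : x ∈ K') : Metric.infEDist x K ≤ η :=
  (le_iSup₂_of_le (f := fun x (_ : x ∈ Metric.closedBall (0 : EuclideanSpace ℝ (Fin n)) 1 ∩ K') =>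
    Metric.infEDist x K) x ⟨hx, hxK⟩ le_rfl).trans ((le_max_right _ _).trans h)

theorem star_conj_sum {n B : ℕ} (A : Fin n → Matrix (Fin B) (Fin B) ℝ)
    (C : Matrix (Fin B) (Fin B) ℝ) (x : EuclideanSpace ℝ (Fin n)) :
    ∑ i, x i • (star C * A i * C) = star C * (∑ i, x i • A i) * C := by
  simp only [Finset.mul_sum, Finset.sum_mul, Matrix.mul_smul, Matrix.smul_mul]

/-- Congruence brings a real positive semidefinite matrix to a diagonal matrix of zeros and
ones. -/
theorem exists_star_mul_mul_eq_diagonal {B : ℕ} {M : Matrix (Fin B) (Fin B) ℝ}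
    (hM : M.PosSemidef) :
    ∃ (C : Matrix (Fin B) (Fin B) ℝ) (θ : Fin B → Bool), IsUnit C ∧
      star C * M * C = Matrix.diagonal fun j => if θ j then 1 else 0 := by
  set U : Matrix (Fin B) (Fin B) ℝ :=
    (hM.isHermitian.eigenvectorUnitary).1 with hU
  set ev := hM.isHermitian.eigenvalues with hev
  -- Zero eigenvalues are scaled by `1` so that the congruence stays invertible.
  set s : Fin B → ℝ := fun j => if ev j = 0 then 1 else (√(ev j))⁻¹ with hs
  have hev0 : ∀ j, 0 ≤ ev j := hM.eigenvalues_nonneg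
  have hs0 : ∀ j, s j ≠ 0 := fun j => by
    simp only [hs]; split_ifs with h
    · exact one_ne_zero
    · exact inv_ne_zero (Real.sqrt_ne_zero'.2 (lt_of_le_of_ne (hev0 j) (Ne.symm h)))
  have hdiag : star U * M * U = Matrix.diagonal ev := by
    have := hM.isHermitian.conjStarAlgAut_star_eigenvectorUnitary
    rw [Unitary.conjStarAlgAut_star_apply] at this
    exact this
  refine ⟨U * Matrix.diagonal s, fun j => decide (ev j ≠ 0), ?_, ?_⟩
  · refine IsUnit.mul ?_ ?_
    · exact Unitary.isUnit_coe
    · rw [Matrix.isUnit_diagonal, Pi.isUnit_iff]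
      exact fun j => isUnit_iff_ne_zero.2 (hs0 j)
  · have : star (U * Matrix.diagonal s) * M * (U * Matrix.diagonal s) =
        Matrix.diagonal s * (star U * M * U) * Matrix.diagonal s := by
      rw [star_mul, Matrix.star_eq_conjTranspose (Matrix.diagonal s),
        Matrix.diagonal_conjTranspose, star_trivial]
      simp only [Matrix.mul_assoc]
    rw [this, hdiag, Matrix.diagonal_mul_diagonal, Matrix.diagonal_mul_diagonal]
    congr 1
    funext j
    by_cases h : ev j = 0
    · simp [h]
    · have hsq := Real.mul_self_sqrt (hev0 j)
      have hne : √(ev j) ≠ 0 :=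
        Real.sqrt_ne_zero'.2 (lt_of_le_of_ne (hev0 j) (Ne.symm h))
      simp only [hs, h, if_false, ne_eq, not_false_eq_true, decide_true, if_true]
      nth_rewrite 2 [← hsq]
      field_simp

theorem quadratic_form_pair_nonneg {B : ℕ} {N : Matrix (Fin B) (Fin B) ℝ} (hN : N.PosSemidef)
    (k l : Fin B) (s : ℝ) : 0 ≤ N k k + s * N k l + s * N l k + s ^ 2 * N l l := by
  have h := hN.dotProduct_mulVec_nonneg (Pi.single k 1 + s • Pi.single l 1)
  simp only [star_trivial, Matrix.mulVec_add, Matrix.mulVec_smul, add_dotProduct, dotProduct_add,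
    smul_dotProduct, dotProduct_smul, Matrix.mulVec_single_one, single_one_dotProduct,
    Matrix.col_apply, smul_eq_mul] at h
  linarith

/-- The matrices of a spectrahedral representation in normal form with respect to `e`. -/
structure IsNormalized {n B : ℕ} (A : Fin n → Matrix (Fin B) (Fin B) ℝ)
    (e : EuclideanSpace ℝ (Fin n)) (b : ℝ) (θ : Fin B → Bool) : Prop where
  sum_eq : ∑ i, e i • A i = Matrix.diagonal fun j => if θ j then 1 else 0
  isHermitian : ∀ i, (A i).IsHermitian
  abs_le : ∀ i k l, |A i k l| ≤ b
  eq_zero : ∀ i k l, θ l = false → A i k l = 0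

/-- Let `P` be the 0/1 diagonal matrix obtained at `e` by congruence. Since `e` is interior, `P ± ρ
A_i` is positive semidefinite for each `i`. This yields symmetry of each `A_i`, the entry bound by
testing on `e_k ± e_l`, and vanishing of the columns where `P` has a zero: a zero diagonal entry of
a positive semidefinite matrix kills its column. -/
theorem exists_isNormalized {n B : ℕ} {A : Fin n → Matrix (Fin B) (Fin B) ℝ}
    {e : EuclideanSpace ℝ (Fin n)} {ρ : ℝ} (hρ : 0 < ρ)
    (h : Metric.closedBall e ρ ⊆ spectrahedralCone A) :
    ∃ (A' : Fin n → Matrix (Fin B) (Fin B) ℝ) (θ : Fin B → Bool),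
      spectrahedralCone A' = spectrahedralCone A ∧ IsNormalized A' e (1 / ρ) θ := by
  obtain ⟨C, θ, hC, hdiag⟩ := exists_star_mul_mul_eq_diagonal
    (show (∑ i, e i • A i).PosSemidef from h (Metric.mem_closedBall_self hρ.le))
  set A' : Fin n → Matrix (Fin B) (Fin B) ℝ := fun i => star C * A i * C with hA'
  have hcone : spectrahedralCone A' = spectrahedralCone A := by
    ext x
    simp only [spectrahedralCone, Set.mem_ofPred_eq, hA', star_conj_sum]
    exact Matrix.IsUnit.posSemidef_star_left_conjugate_iff hC
  have hsum : ∑ i, e i • A' i = Matrix.diagonal fun j => if θ j then 1 else 0 := by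
    rw [← hdiag, hA', star_conj_sum]
  have hpsd : ∀ i, ∀ s : ℝ, |s| ≤ ρ →
      ((Matrix.diagonal fun j => if θ j then 1 else 0) + s • A' i).PosSemidef := by
    intro i s hs
    have hmem : e + s • EuclideanSpace.single i (1 : ℝ) ∈ spectrahedralCone A' := by
      rw [hcone]
      apply h
      rw [Metric.mem_closedBall, dist_eq_norm, add_sub_cancel_left, norm_smul]
      simpa using hs
    have hval : ∑ j, (EuclideanSpace.single i (1 : ℝ)) j • A' j = A' i := by
      rw [Finset.sum_eq_single i]
      · simp
      · intro j _ hj; simp [hj]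
      · simp
    have : (∑ j, (e + s • EuclideanSpace.single i (1 : ℝ)) j • A' j).PosSemidef := hmem
    rwa [sum_add_smul_matrix, hsum, hval] at this
  have hherm : ∀ i, (A' i).IsHermitian := fun i => by
    have h1 := (hpsd i ρ (abs_of_pos hρ).le).isHermitian
    have h2 : (ρ • A' i).IsHermitian := by
      have hd : (Matrix.diagonal fun j => if θ j then (1 : ℝ) else 0).IsHermitian :=
        Matrix.isHermitian_diagonal _
      simpa using h1.sub hd
    refine Matrix.IsHermitian.ext fun k l => mul_left_cancel₀ hρ.ne' ?_
    simpa using h2.apply k l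
  refine ⟨A', θ, hcone, hsum, hherm, fun i k l => ?_, fun i k l hl => ?_⟩
  · have hsym : A' i l k = A' i k l := by
      have := (hherm i).apply k l
      simpa using this
    have hP : ∀ j, (if θ j then (1 : ℝ) else 0) ≤ 1 := fun j => by split_ifs <;> norm_num
    have hplus := hpsd i ρ (abs_of_pos hρ).le
    have hminus := hpsd i (-ρ) (by rw [abs_neg, abs_of_pos hρ])
    have p1 := quadratic_form_pair_nonneg hplus k l 1
    have p2 := quadratic_form_pair_nonneg hplus k l (-1)
    have m1 := quadratic_form_pair_nonneg hminus k l 1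
    have m2 := quadratic_form_pair_nonneg hminus k l (-1)
    simp only [Matrix.add_apply, Matrix.smul_apply, smul_eq_mul, Matrix.diagonal_apply_eq, hsym]
      at p1 p2 m1 m2
    have := hP k
    have := hP l
    rw [abs_le, neg_le, le_div_iff₀ hρ, le_div_iff₀ hρ]
    constructor <;> linarith
  · have hplus := hpsd i ρ (abs_of_pos hρ).le
    have hminus := hpsd i (-ρ) (by rw [abs_neg, abs_of_pos hρ])
    have hll : A' i l l = 0 := by
      have h1 := hplus.diag_nonneg (i := l)
      have h2 := hminus.diag_nonneg (i := l)
      simp only [Matrix.add_apply, Matrix.smul_apply, smul_eq_mul, Matrix.diagonal_apply_eq,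
        hl, Bool.false_eq_true, if_false] at h1 h2
      nlinarith
    have hz := (hplus.dotProduct_mulVec_zero_iff (Pi.single l 1)).1 (by
      simp [hl, hll])
    have hzk := congrFun hz k
    rw [Matrix.mulVec_single_one] at hzk
    have hd : (Matrix.diagonal fun j => if θ j then (1 : ℝ) else 0) k l = 0 := by
      by_cases hkl : k = l
      · subst hkl; simp [hl]
      · exact Matrix.diagonal_apply_ne _ hkl
    simp only [Matrix.col_apply, Matrix.add_apply, Matrix.smul_apply, smul_eq_mul, hd, zero_add,
      Pi.zero_apply] at hzk
    exact (mul_eq_zero.1 hzk).resolve_left hρ.ne'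

/-- Nearby normalized representations define nearby cones. -/
theorem add_smul_mem_spectrahedralCone {n B : ℕ} {A A' : Fin n → Matrix (Fin B) (Fin B) ℝ}
    {e x : EuclideanSpace ℝ (Fin n)} {b δ ζ : ℝ} {θ θ' : Fin B → Bool}
    (hA : IsNormalized A e b θ) (hA' : IsNormalized A' e b θ')
    (hAA : ∀ i k l, |A i k l - A' i k l| ≤ ζ) (he : ∀ i, |e i| ≤ 1) (hx : ∀ i, |x i| ≤ 1)
    (hζ0 : 0 ≤ ζ) (hζ : n * ζ < 1) (hδ : n * ζ * B ≤ δ) (hxA : x ∈ spectrahedralCone A) :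
    x + δ • e ∈ spectrahedralCone A' := by
  have hentry : ∀ y : EuclideanSpace ℝ (Fin n), (∀ i, |y i| ≤ 1) → ∀ k l,
      |(∑ i, y i • A' i) k l - (∑ i, y i • A i) k l| ≤ n * ζ := by
    intro y hy k l
    rw [Matrix.sum_apply, Matrix.sum_apply, ← Finset.sum_sub_distrib]
    refine (Finset.abs_sum_le_sum_abs _ _).trans ((Finset.sum_le_card_nsmul _ _ ζ
      fun i _ => ?_).trans (by simp))
    rw [Matrix.smul_apply, Matrix.smul_apply, smul_eq_mul, smul_eq_mul, ← mul_sub, abs_mul,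
      abs_sub_comm]
    exact (mul_le_mul (hy i) (hAA i k l) (abs_nonneg _) zero_le_one).trans (one_mul ζ).le
  -- At `e` both matrices are 0/1 diagonals whose entries differ by less than `1`.
  have hθ : θ' = θ := by
    funext j
    have := (hentry e he j j).trans_lt hζ
    rw [hA.sum_eq, hA'.sum_eq, Matrix.diagonal_apply_eq, Matrix.diagonal_apply_eq] at this
    cases h1 : θ j <;> cases h2 : θ' j <;> simp [h1, h2] at this ⊢
  subst hθ
  have hherm : ∀ (A : Fin n → Matrix (Fin B) (Fin B) ℝ), (∀ i, (A i).IsHermitian) →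
      ∀ y : EuclideanSpace ℝ (Fin n), (∑ i, y i • A i).IsHermitian := by
    intro A hA y
    rw [Matrix.IsHermitian, Matrix.conjTranspose_sum]
    refine Finset.sum_congr rfl fun i _ => ?_
    rw [Matrix.conjTranspose_smul, hA i, star_trivial]
  have hzero : ∀ (A : Fin n → Matrix (Fin B) (Fin B) ℝ), IsNormalized A e b θ' →
      ∀ k l, (θ' k = false ∨ θ' l = false) → (∑ i, x i • A i) k l = 0 := by
    intro A hA k l hkl
    rw [Matrix.sum_apply]
    refine Finset.sum_eq_zero fun i _ => ?_
    have : A i k l = 0 := by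
      rcases hkl with h | h
      · have := (hA.isHermitian i).apply k l
        rw [← this, hA.eq_zero i l k h, star_zero]
      · exact hA.eq_zero i k l h
    rw [Matrix.smul_apply, this, smul_zero]
  change (∑ i, (x + δ • e) i • A' i).PosSemidef
  refine Matrix.PosSemidef.of_dotProduct_mulVec_nonneg (hherm A' hA'.isHermitian _) fun v => ?_
  rw [sum_add_smul_matrix, hA'.sum_eq]
  set M := ∑ i, x i • A i with hM
  set M' := ∑ i, x i • A' i with hM'
  -- Shifting by `δ • e` adds only `δ` times a projection, so the error must be controlled on its
  -- range alone. It is, because both tuples vanish off the common support; Cauchy-Schwarz then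
  -- costs the factor `B`.
  set w : Fin B → ℝ := fun j => if θ' j then |v j| else 0 with hw
  have hw0 : ∀ j, 0 ≤ w j := fun j => by simp only [hw]; split_ifs <;> simp
  have hv0 : 0 ≤ star v ⬝ᵥ M.mulVec v := Matrix.PosSemidef.dotProduct_mulVec_nonneg hxA v
  have hB : 0 ≤ (n : ℝ) * ζ := mul_nonneg (Nat.cast_nonneg n) hζ0
  have hE : |star v ⬝ᵥ (M' - M).mulVec v| ≤ n * ζ * (∑ j, w j) ^ 2 := by
    have : star v ⬝ᵥ (M' - M).mulVec v = ∑ k, ∑ l, v k * ((M' k l - M k l) * v l) := by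
      simp only [star_trivial, dotProduct, Matrix.mulVec, Finset.mul_sum, Matrix.sub_apply]
    rw [this, sq, Finset.sum_mul_sum, Finset.mul_sum]
    refine (Finset.abs_sum_le_sum_abs _ _).trans (Finset.sum_le_sum fun k _ => ?_)
    rw [Finset.mul_sum]
    refine (Finset.abs_sum_le_sum_abs _ _).trans (Finset.sum_le_sum fun l _ => ?_)
    by_cases hk : θ' k = false ∨ θ' l = false
    · have z : M k l = 0 := hzero A hA k l hk
      have z' : M' k l = 0 := hzero A' hA' k l hk
      rw [z, z']
      simpa using mul_nonneg hB (mul_nonneg (hw0 k) (hw0 l))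
    · simp only [not_or, Bool.not_eq_false] at hk
      simp only [hw, hk.1, hk.2, if_true]
      rw [abs_mul, abs_mul]
      have := mul_le_mul_of_nonneg_right (hentry x hx k l) (mul_nonneg (abs_nonneg (v k))
        (abs_nonneg (v l)))
      linarith
  have hCS : (∑ j, w j) ^ 2 ≤ B * ∑ j, w j ^ 2 := by
    simpa using sq_sum_le_card_mul_sum_sq (s := (Finset.univ : Finset (Fin B))) (f := w)
  have hP : star v ⬝ᵥ (Matrix.diagonal fun j => if θ' j then (1 : ℝ) else 0).mulVec v =
      ∑ j, w j ^ 2 := by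
    simp only [star_trivial, dotProduct, Matrix.mulVec_diagonal]
    refine Finset.sum_congr rfl fun j _ => ?_
    simp only [hw]; split_ifs
    · rw [sq_abs]; ring
    · simp
  have hdecomp : star v ⬝ᵥ (M' + δ • Matrix.diagonal fun j => if θ' j then (1 : ℝ) else 0).mulVec v
      = star v ⬝ᵥ M.mulVec v + star v ⬝ᵥ (M' - M).mulVec v + δ * ∑ j, w j ^ 2 := by
    rw [Matrix.add_mulVec, Matrix.smul_mulVec, dotProduct_add, dotProduct_smul, hP,
      Matrix.sub_mulVec, dotProduct_sub, smul_eq_mul]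
    ring
  rw [hdecomp]
  have h1 := neg_abs_le (star v ⬝ᵥ (M' - M).mulVec v)
  have h2 := mul_le_mul_of_nonneg_left hCS hB
  have h3 := mul_le_mul_of_nonneg_right hδ
    (Finset.sum_nonneg fun j (_ : j ∈ Finset.univ) => sq_nonneg (w j))
  linarith

end Spectrahedra

/-! ### Counting patterns by rounded representations. -/

section Counting

/-- The entries of a tuple of matrices, extended by zero and rounded to multiples of `ζ`. -/
noncomputable def roundedEntry {n B : ℕ} (A : Fin n → Matrix (Fin B) (Fin B) ℝ) (ζ : ℝ)
    (i : Fin n) (k l : ℕ) : ℤ :=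
  if h : k < B ∧ l < B then round (A i ⟨k, h.1⟩ ⟨l, h.2⟩ / ζ) else 0

theorem abs_roundedEntry_le {n B Q : ℕ} {A : Fin n → Matrix (Fin B) (Fin B) ℝ} {b ζ : ℝ}
    (hζ : 0 < ζ) (hA : ∀ i k l, |A i k l| ≤ b) (hQ : b / ζ + 1 ≤ Q) (i : Fin n) (k l : ℕ) :
    |roundedEntry A ζ i k l| ≤ Q := by
  unfold roundedEntry
  split_ifs with h
  · have h1 := abs_le.1 (abs_sub_round (A i ⟨k, h.1⟩ ⟨l, h.2⟩ / ζ))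
    have h2 : |A i ⟨k, h.1⟩ ⟨l, h.2⟩ / ζ| ≤ b / ζ := by
      rw [abs_div, abs_of_pos hζ]
      exact div_le_div_of_nonneg_right (hA _ _ _) hζ.le
    have h3 : |(round (A i ⟨k, h.1⟩ ⟨l, h.2⟩ / ζ) : ℝ)| ≤ Q := by
      rw [abs_le] at h2 ⊢
      constructor <;> linarith
    exact_mod_cast h3
  · simp

/-- Entries rounding to the same multiple of `ζ` differ by at most `ζ`. -/
theorem add_smul_mem_of_roundedEntry_eq {n B B' : ℕ} {A : Fin n → Matrix (Fin B) (Fin B) ℝ}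
    {A' : Fin n → Matrix (Fin B') (Fin B') ℝ} {e x : EuclideanSpace ℝ (Fin n)} {b δ ζ : ℝ}
    {θ : Fin B → Bool} {θ' : Fin B' → Bool} (hBB : B = B')
    (hA : IsNormalized A e b θ) (hA' : IsNormalized A' e b θ')
    (hAA : ∀ i k l, k < B → l < B → roundedEntry A ζ i k l = roundedEntry A' ζ i k l)
    (he : ∀ i, |e i| ≤ 1) (hx : ∀ i, |x i| ≤ 1) (hζ0 : 0 < ζ) (hζ : n * ζ < 1)
    (hδ : n * ζ * B ≤ δ) (hxA : x ∈ spectrahedralCone A) :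
    x + δ • e ∈ spectrahedralCone A' := by
  subst hBB
  refine add_smul_mem_spectrahedralCone hA hA' (fun i k l => ?_) he hx hζ0.le hζ hδ hxA
  have h := hAA i k l k.2 l.2
  rw [roundedEntry, roundedEntry, dif_pos ⟨k.2, l.2⟩, dif_pos ⟨k.2, l.2⟩] at h
  have h1 := abs_le.1 (abs_sub_round (A i k l / ζ))
  have h2 := abs_le.1 (abs_sub_round (A' i k l / ζ))
  simp only [Fin.eta] at h
  rw [h] at h1
  have h3 : |A i k l / ζ - A' i k l / ζ| ≤ 1 := by
    rw [abs_le]; constructor <;> linarith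
  rwa [← sub_div, abs_div, abs_of_pos hζ0, div_le_one hζ0] at h3

/-- If all the patterns of inclusion and disjointness on a family of balls are realized by sets
that are approximated by spectrahedral cones, the family is small. -/
theorem two_pow_card_le_of_approx {n Bm Q : ℕ} {I : Type*} {Λ : Finset I}
    {e : EuclideanSpace ℝ (Fin n)} {x : I → EuclideanSpace ℝ (Fin n)} {r η ζ : ℝ}
    {K : Set I → Set (EuclideanSpace ℝ (Fin n))} (hr : 0 < r) (hη : η < r / 2)
    (he1 : Metric.closedBall e r ⊆ Metric.closedBall 0 1)
    (hx1 : ∀ S ∈ Λ, Metric.closedBall (x S) r ⊆ Metric.closedBall 0 1)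
    (heK : ∀ s, Metric.closedBall e r ⊆ K s)
    (hin : ∀ s : Set I, ∀ S ∈ Λ, S ∈ s → Metric.closedBall (x S) r ⊆ K s)
    (hout : ∀ s : Set I, ∀ S ∈ Λ, S ∉ s → Disjoint (Metric.closedBall (x S) r) (K s))
    (hrep : ∀ s : Set I, ∃ B, B ≤ Bm ∧ ∃ A : Fin n → Matrix (Fin B) (Fin B) ℝ,
      hdist (K s) (spectrahedralCone A) ≤ ENNReal.ofReal η)
    (hζ0 : 0 < ζ) (hζ : n * ζ < 1) (hδ : n * ζ * Bm ≤ r / 2) (hQ : 1 / (r / 2) / ζ + 1 ≤ Q) :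
    2 ^ Λ.card ≤ (Bm + 1) * (((2 * Q + 1) ^ Bm) ^ Bm) ^ n := by
  have he1' : ‖e‖ ≤ 1 := by
    simpa using he1 (Metric.mem_closedBall_self hr.le)
  have hnorm : ∀ s : Set I, ∃ B, B ≤ Bm ∧ ∃ (A : Fin n → Matrix (Fin B) (Fin B) ℝ) (θ : Fin B → Bool),
      IsNormalized A e (1 / (r / 2)) θ ∧ (∀ S ∈ Λ, S ∈ s → x S ∈ spectrahedralCone A) ∧
      ∀ S ∈ Λ, S ∉ s → x S + (r / 2) • e ∉ spectrahedralCone A := by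
    intro s
    obtain ⟨B, hB, A, hA⟩ := hrep s
    have hball : ∀ z, Metric.closedBall z r ⊆ Metric.closedBall 0 1 →
        Metric.closedBall z r ⊆ K s → Metric.closedBall z (r / 2) ⊆ spectrahedralCone A :=
      fun z hz hzK => closedBall_half_subset_of_infEDist_le ⟨0, zero_mem_spectrahedralCone A⟩
        (isClosed_spectrahedralCone A) (convex_spectrahedralCone A) hr hη fun y hy =>
          infEDist_le_of_hdist_le hA (hz hy) (hzK hy)
    obtain ⟨A', θ, hcone, hn⟩ := exists_isNormalized (half_pos hr) (hball e he1 (heK s))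
    refine ⟨B, hB, A', θ, hn, fun S hS hSs => ?_, fun S hS hSs hmem => ?_⟩
    · rw [hcone]
      exact hball _ (hx1 S hS) (hin s S hS hSs) (Metric.mem_closedBall_self (half_pos hr).le)
    · rw [hcone] at hmem
      have hdist_e : dist (x S + (r / 2) • e) (x S) ≤ r / 2 := by
        rw [dist_eq_norm, add_sub_cancel_left, norm_smul, Real.norm_eq_abs,
          abs_of_pos (half_pos hr)]
        exact mul_le_of_le_one_right (half_pos hr).le he1'
      -- The shifted centre is still `r / 2` deep inside a ball disjoint from `K s`, so a cone
      -- `η`-close to `K s` misses it. This leaves room for the shift caused by rounding.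
      have hxe : x S + (r / 2) • e ∈ Metric.closedBall (x S) r :=
        hdist_e.trans (half_le_self hr.le)
      have hle := infEDist_le_of_hdist_le' hA (hx1 S hS hxe) hmem
      have hfar : ENNReal.ofReal (r / 2) ≤ Metric.infEDist (x S + (r / 2) • e) (K s) := by
        rw [Metric.le_infEDist]
        intro y hy
        rw [edist_dist]
        refine ENNReal.ofReal_le_ofReal ?_
        by_contra! hlt
        refine Set.disjoint_left.1 (hout s S hS hSs) ?_ hy
        rw [Metric.mem_closedBall]
        have := dist_triangle_left y (x S) (x S + (r / 2) • e)
        linarith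
      have := hfar.trans hle
      rw [ENNReal.ofReal_le_ofReal_iff'] at this
      rcases this with h | h <;> linarith
  choose B hB A θ hn hA hA' using hnorm
  have hbound := fun s i k l => abs_le.1 (abs_roundedEntry_le hζ0 (hn s).abs_le hQ i k l)
  let code : Λ.powerset → Fin (Bm + 1) ×
      (Fin n → Fin Bm → Fin Bm → Finset.Icc (-(Q : ℤ)) Q) := fun s =>
    (⟨B s.1, Nat.lt_succ_of_le (hB _)⟩, fun i k l =>
      ⟨roundedEntry (A s.1) ζ i k l, Finset.mem_Icc.2 (hbound _ _ _ _)⟩)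
  -- If `S` lay in `s` but not in `s'`, equal codes would carry `x S` from the first cone to `x S +
  -- (r / 2) • e` in the second, which excludes that point.
  have hsub : ∀ s s' : Λ.powerset, code s = code s' → s.1 ⊆ s'.1 := by
    intro s s' h S hS
    by_contra hS'
    have hSΛ : S ∈ Λ := Finset.mem_powerset.1 s.2 hS
    have hBB : B s.1 = B s'.1 := congrArg (fun c => (c.1 : ℕ)) h
    refine hA' s'.1 S hSΛ (by simpa using hS') ?_
    refine add_smul_mem_of_roundedEntry_eq hBB (hn s.1) (hn s'.1) (fun i k l hk hl => ?_)
      (fun i => (PiLp.norm_apply_le e i).trans he1') (fun i => (PiLp.norm_apply_le (x S) i).trans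
        (by simpa using hx1 S hSΛ (Metric.mem_closedBall_self hr.le))) hζ0 hζ ?_
      (hA s.1 S hSΛ (by simpa using hS))
    · have := congrArg (fun c => (c.2 i ⟨k, hk.trans_le (hB _)⟩ ⟨l, hl.trans_le (hB _)⟩ : ℤ)) h
      exact this
    · refine le_trans ?_ hδ
      have : (B s.1 : ℝ) ≤ Bm := by exact_mod_cast hB _
      exact mul_le_mul_of_nonneg_left this (by positivity)
  have hinj : Function.Injective code := fun s s' h =>
    Subtype.ext (Finset.Subset.antisymm (hsub s s' h) (hsub s' s h.symm))
  have hcard := Fintype.card_le_of_injective code hinj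
  have hIcc : (Q + 1 + Q : ℤ).toNat = 2 * Q + 1 := by omega
  simpa [Fintype.card_coe, Finset.card_powerset, hIcc] using hcard

end Counting

/-! ### Binomial and exponential estimates. -/

section Numerics

/-- Induction via `(m + 1) * m.choose d = (m + 1).choose (d + 1) * (d + 1)` and `(m + 1) / (d + 1) ≤
m / d`. -/
theorem pow_le_choose_mul_pow {m d : ℕ} (h : d ≤ m) : m ^ d ≤ m.choose d * d ^ d := by
  induction m generalizing d with
  | zero => obtain rfl : d = 0 := by omega
            simp
  | succ m ih =>
    rcases Nat.eq_zero_or_pos d with rfl | hd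
    · simp
    obtain ⟨d, rfl⟩ : ∃ j, d = j + 1 := ⟨d - 1, by omega⟩
    have hdm : d ≤ m := by omega
    have key : (m + 1) ^ d ≤ m.choose d * (d + 1) ^ d := by
      rcases Nat.eq_zero_or_pos d with rfl | hd
      · simp
      refine Nat.le_of_mul_le_mul_right ?_ (pow_pos hd d)
      calc (m + 1) ^ d * d ^ d = ((m + 1) * d) ^ d := (mul_pow _ _ _).symm
        _ ≤ (m * (d + 1)) ^ d := Nat.pow_le_pow_left (by nlinarith) d
        _ = m ^ d * (d + 1) ^ d := mul_pow _ _ _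
        _ ≤ m.choose d * d ^ d * (d + 1) ^ d := Nat.mul_le_mul_right _ (ih hdm)
        _ = m.choose d * (d + 1) ^ d * d ^ d := by ring
    calc (m + 1) ^ (d + 1) = (m + 1) * (m + 1) ^ d := by ring
      _ ≤ (m + 1) * (m.choose d * (d + 1) ^ d) := Nat.mul_le_mul_left _ key
      _ = (m + 1) * m.choose d * (d + 1) ^ d := by ring
      _ = (m + 1).choose (d + 1) * (d + 1) * (d + 1) ^ d := by rw [Nat.add_one_mul_choose_eq]
      _ = (m + 1).choose (d + 1) * (d + 1) ^ (d + 1) := by ring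

theorem div_pow_le_choose {m d : ℕ} (h : d ≤ m) : ((m : ℝ) / d) ^ d ≤ m.choose d := by
  rcases Nat.eq_zero_or_pos d with rfl | hd
  · simp
  rw [div_pow, div_le_iff₀ (by positivity)]
  exact_mod_cast pow_le_choose_mul_pow h

/-- From `log u ≤ u - 1`; the bound is uniform in `d`, which also covers `d > n`. -/
theorem rpow_ratio_le_exp {n d : ℕ} (hn : 1 ≤ n) (hd : 1 ≤ d) :
    ((n : ℝ) / d) ^ (1 / 16 * (d : ℝ)) ≤ Real.exp (n / 16) := by
  have hd0 : (0 : ℝ) < d := by exact_mod_cast hd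
  have hn0 : (0 : ℝ) < n := by exact_mod_cast hn
  rw [Real.rpow_def_of_pos (by positivity)]
  refine Real.exp_le_exp.2 ?_
  have h1 := Real.log_le_sub_one_of_pos (show 0 < (n : ℝ) / d by positivity)
  calc Real.log (n / d) * (1 / 16 * d) ≤ (n / d - 1) * (1 / 16 * d) :=
        mul_le_mul_of_nonneg_right h1 (by positivity)
    _ = n / 16 - d / 16 := by field_simp
    _ ≤ n / 16 := by linarith

/-- The number of subsets of size `min d ((n - 1) / 2)` beats `(n / d) ^ (d / 8)` by a polynomial
factor. -/
theorem eventually_lt_choose :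
    ∃ N₀ : ℕ, ∀ n d : ℕ, N₀ ≤ n → N₀ ≤ d →
      22 * (n : ℝ) ^ 3 * (((n : ℝ) / d) ^ (1 / 16 * (d : ℝ))) ^ 2 <
        (n - 1).choose (min d ((n - 1) / 2)) := by
  have hlog2 : (0.6931471803 : ℝ) < Real.log 2 := Real.log_two_gt_d9
  obtain ⟨N₁, hN₁⟩ : ∃ N₁ : ℕ, ∀ d : ℕ, N₁ ≤ d → Real.log d ≤ Real.log 2 / 32 * d := by
    have h := Real.isLittleO_log_id_atTop.bound (show 0 < Real.log 2 / 32 by positivity)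
    obtain ⟨N, hN⟩ := Filter.eventually_atTop.1
      ((tendsto_natCast_atTop_atTop (R := ℝ)).eventually h)
    refine ⟨N, fun d hd => ?_⟩
    have := hN d hd
    simp only [id_eq, Real.norm_eq_abs, Nat.abs_cast] at this
    exact (le_abs_self _).trans this
  obtain ⟨N₂, hN₂⟩ : ∃ N₂ : ℕ, ∀ n : ℕ, N₂ ≤ n → 44 * (n : ℝ) ^ 3 < Real.exp (n / 8) := by
    have h := tendsto_pow_const_div_const_pow_of_one_lt 3
      (show 1 < Real.exp (1 / 8) by rw [Real.one_lt_exp_iff]; norm_num)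
    obtain ⟨N, hN⟩ := Filter.eventually_atTop.1
      (h.eventually (gt_mem_nhds (show (0 : ℝ) < 1 / 44 by norm_num)))
    refine ⟨N, fun n hn => ?_⟩
    have := hN n hn
    rw [← Real.exp_nat_mul, div_lt_iff₀ (Real.exp_pos _)] at this
    rw [show (n : ℝ) / 8 = n * (1 / 8) by ring]
    linarith
  refine ⟨max 32 (max N₁ N₂), fun n d hn hd => ?_⟩
  simp only [max_le_iff] at hn hd
  have hn32 : (32 : ℝ) ≤ n := by exact_mod_cast hn.1
  have hd32 : (32 : ℝ) ≤ d := by exact_mod_cast hd.1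
  have hY0 : 0 < ((n : ℝ) / d) ^ (1 / 16 * (d : ℝ)) := by positivity
  rcases le_or_gt d ((n - 1) / 2) with hdn | hdn
  · rw [min_eq_left hdn]
    have hcast : ((n - 1 : ℕ) : ℝ) = n - 1 := by rw [Nat.cast_sub (by omega)]; simp
    have h2d : 2 * (d : ℝ) ≤ n - 1 := by
      have : 2 * d + 1 ≤ n := by omega
      have : (2 * d + 1 : ℝ) ≤ n := by exact_mod_cast this
      linarith
    refine lt_of_lt_of_le ?_ (div_pow_le_choose (by omega))
    rw [hcast]
    have hratio : ((n : ℝ) / d) ≤ ((n - 1) / d) ^ 2 := by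
      rw [div_pow, div_le_div_iff₀ (by positivity) (by positivity)]
      nlinarith [mul_nonneg (show (0 : ℝ) ≤ d by linarith) (show (0 : ℝ) ≤ n by linarith)]
    -- With `Y = (n / d) ^ (d / 16)` this says `n ≤ Y`, so `22 * n ^ 3 * Y ^ 2` is below `Y ^ 8`,
    -- which the binomial coefficient dominates. If `d ^ 2 ≤ n`, then `log (n / d)` is at least half
    -- of `log n` and `d ≥ 32` suffices; otherwise `log n < 2 * log d`, which is small against `d`,
    -- and `n / d ≥ 2`.
    have hlogn : Real.log n ≤ Real.log (n / d) * (1 / 16 * d) := by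
      have hlogd : 0 ≤ Real.log d := Real.log_nonneg (by linarith)
      have hlogn0 : 0 ≤ Real.log n := Real.log_nonneg (by linarith)
      have hdiv : Real.log (n / d) = Real.log n - Real.log d :=
        Real.log_div (by linarith) (by linarith)
      rcases le_or_gt ((d : ℝ) ^ 2) n with h | h
      · have h1 : 2 * Real.log d ≤ Real.log n := by
          have := Real.log_le_log (by positivity) h
          rwa [Real.log_pow, Nat.cast_ofNat] at this
        have h2 : 1 / 2 * Real.log n ≤ Real.log (n / d) := by rw [hdiv]; linarith
        calc Real.log n = 1 / 2 * Real.log n * 2 := by ring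
          _ ≤ Real.log (n / d) * (1 / 16 * d) :=
            mul_le_mul h2 (by linarith) (by norm_num) (by linarith)
      · have h1 : Real.log n ≤ 2 * Real.log d := by
          have := Real.log_le_log (by linarith) h.le
          rwa [Real.log_pow, Nat.cast_ofNat] at this
        have h2 : Real.log 2 ≤ Real.log (n / d) := by
          refine Real.log_le_log two_pos ?_
          rw [le_div_iff₀ (by linarith)]; linarith
        have h3 := hN₁ d hd.2.1
        have h4 := mul_le_mul_of_nonneg_right h2 (show 0 ≤ 1 / 16 * (d : ℝ) by positivity)
        linarith
    set Y := ((n : ℝ) / d) ^ (1 / 16 * (d : ℝ)) with hY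
    have hYn : (n : ℝ) ≤ Y := by
      rw [hY, Real.rpow_def_of_pos (by positivity), ← Real.log_le_iff_le_exp (by linarith)]
      exact hlogn
    have hY16 : Y ^ 16 ≤ (((n : ℝ) - 1) / d) ^ d * (((n : ℝ) - 1) / d) ^ d := by
      have : Y ^ 16 = ((n : ℝ) / d) ^ d := by
        rw [hY, ← Real.rpow_natCast, ← Real.rpow_mul (by positivity), ← Real.rpow_natCast]
        congr 1; push_cast; ring
      rw [this, ← pow_two, ← pow_mul, mul_comm d 2, pow_mul]
      exact pow_le_pow_left₀ (by positivity) hratio d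
    have hY8 : Y ^ 8 ≤ (((n : ℝ) - 1) / d) ^ d := by
      have h0 : 0 ≤ (((n : ℝ) - 1) / d) ^ d := pow_nonneg (div_nonneg (by linarith) (by linarith)) _
      refine le_of_sq_le_sq ?_ h0
      rw [← pow_mul, pow_two]; exact hY16
    refine lt_of_lt_of_le ?_ hY8
    have h3 : (n : ℝ) ^ 3 ≤ Y ^ 3 := pow_le_pow_left₀ (by linarith) hYn 3
    have h4 : (22 : ℝ) < Y ^ 3 := by
      have : (32 : ℝ) ^ 3 ≤ Y ^ 3 := pow_le_pow_left₀ (by norm_num) (hn32.trans hYn) 3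
      linarith
    calc 22 * (n : ℝ) ^ 3 * Y ^ 2 ≤ 22 * Y ^ 3 * Y ^ 2 := by gcongr
      _ < Y ^ 3 * Y ^ 3 * Y ^ 2 := by gcongr
      _ = Y ^ 8 := by ring
  -- For large `d` the left side is at most `22 * n ^ 3 * exp (n / 8)`, while the near-central
  -- binomial coefficient is at least `2 ^ D ≥ exp (n / 4) / 2`.
  · rw [min_eq_right hdn.le]
    set D := (n - 1) / 2 with hD
    have h2D : (2 : ℝ) ^ D ≤ (n - 1).choose D := by
      have hD1 : 0 < D := by omega
      have hD0 : (0 : ℝ) < D := by exact_mod_cast hD1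
      refine le_trans (pow_le_pow_left₀ (by norm_num) ?_ D) (div_pow_le_choose (by omega))
      rw [le_div_iff₀ hD0]
      have : 2 * D ≤ n - 1 := by omega
      exact_mod_cast this
    have hDn : (n : ℝ) ≤ 2 * D + 2 := by
      have : n ≤ 2 * D + 2 := by omega
      exact_mod_cast this
    have hY := rpow_ratio_le_exp (n := n) (d := d) (by omega) (by omega)
    have hY2 : (((n : ℝ) / d) ^ (1 / 16 * (d : ℝ))) ^ 2 ≤ Real.exp (n / 8) := by
      refine (pow_le_pow_left₀ hY0.le hY 2).trans (le_of_eq ?_)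
      rw [← Real.exp_nat_mul]; congr 1; push_cast; ring
    have hexp : Real.exp (n / 4) ≤ 2 * 2 ^ D := by
      rw [← pow_succ', ← Real.exp_log (show (0 : ℝ) < 2 ^ (D + 1) by positivity), Real.log_pow]
      refine Real.exp_le_exp.2 ?_
      push_cast
      nlinarith
    refine lt_of_lt_of_le ?_ h2D
    have h8 := hN₂ n hn.2.2
    have : Real.exp (n / 4) = Real.exp (n / 8) * Real.exp (n / 8) := by
      rw [← Real.exp_add]; congr 1; ring
    nlinarith [Real.exp_pos ((n : ℝ) / 8), mul_le_mul_of_nonneg_left hY2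
      (show (0 : ℝ) ≤ 22 * (n : ℝ) ^ 3 by positivity)]

end Numerics

/-! ### Assembly: choice of parameters and the final contradiction. -/

theorem theorem1 :
    ∃ κ : ℝ, 0 < κ ∧ ∃ N₀ : ℕ, ∀ n d : ℕ, N₀ ≤ n → N₀ ≤ d →
      ∃ (p : MvPolynomial (Fin n) ℝ) (e : EuclideanSpace ℝ (Fin n)),
        IsHyperbolic d p e ∧
        ∀ B : ℕ, (B : ℝ) ≤ ((n : ℝ) / (d : ℝ)) ^ (κ * (d : ℝ)) →
          ¬ ∃ A : Fin n → Matrix (Fin B) (Fin B) ℝ,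
            IsApproxSpectrahedralRep (1 / (n : ℝ) ^ (4 * n * d)) (hyperbolicityCone p e) A := by
  obtain ⟨N₁, hN₁⟩ := eventually_lt_choose
  refine ⟨1 / 16, by norm_num, max 32 N₁, fun n d hn hd => ?_⟩
  rw [max_le_iff] at hn hd
  by_contra! hcon
  set D := min d ((n - 1) / 2) with hD
  have hDd : D ≤ d := min_le_left _ _
  have hDn : D ≤ (n - 1) / 2 := min_le_right _ _
  have hD1 : 1 ≤ D := le_min (by omega) (by omega)
  obtain ⟨Λ, e, x, hcard, he1, hx1, hfam⟩ :=
    exists_hyperbolic_test_family (n := n) (D := D) (d := d) (by omega) hD1 (by omega) hDd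
  choose p hp heK htest using hfam
  set Y := ((n : ℝ) / d) ^ (1 / 16 * (d : ℝ)) with hY
  have hY0 : 0 ≤ Y := by positivity
  have hBY : (⌊Y⌋₊ : ℝ) ≤ Y := Nat.floor_le hY0
  have hnpos : (32 : ℝ) ≤ n := by exact_mod_cast hn.1
  have hB2 : (⌊Y⌋₊ : ℝ) ≤ 2 ^ n := by
    refine hBY.trans ((rpow_ratio_le_exp (by omega) (by omega)).trans ?_)
    rw [← Real.exp_log (show (0 : ℝ) < 2 ^ n by positivity), Real.log_pow]
    refine Real.exp_le_exp.2 ?_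
    nlinarith [Real.log_two_gt_d9]
  have hn2 : (n : ℝ) ≤ 2 ^ n := by exact_mod_cast Nat.lt_two_pow_self.le
  set r : ℝ := (1 / 2 ^ n) ^ (D + 8) with hr
  have hr0 : 0 < r := by positivity
  have hrpow : r = 1 / 2 ^ (n * (D + 8)) := by rw [hr, div_pow, one_pow, ← pow_mul]
  have hr1 : r ≤ 1 := by
    rw [hrpow]; exact div_le_one_of_le₀ (one_le_pow₀ one_le_two) (by positivity)
  have hη : 1 / (n : ℝ) ^ (4 * n * d) < r / 2 := by
    rw [hrpow, div_div, ← pow_succ]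
    refine one_div_lt_one_div_of_lt (by positivity) ?_
    -- Using only `n ≥ 16`, `1 / η` is at least `2 ^ (16 * n * d)`, far above `2 / r = 2 ^ (n * (D +
    -- 8) + 1)`.
    have h1 : (2 : ℝ) ^ (4 * n * d * 4) ≤ n ^ (4 * n * d) := by
      rw [mul_comm _ 4, pow_mul]
      exact pow_le_pow_left₀ (by norm_num) (by linarith) _
    refine lt_of_lt_of_le (pow_lt_pow_right₀ one_lt_two ?_) h1
    have h2 : n * D ≤ n * d := Nat.mul_le_mul_left _ hDd
    have h3 : n * 32 ≤ n * d := Nat.mul_le_mul_left _ hd.1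
    nlinarith
  -- As `n` and the dimension are both at most `2 ^ n`, this mesh gives `n * ζ * B ≤ r / 4`.
  set ζ : ℝ := r / 2 ^ (2 * n + 2) with hζ
  have h4n : (2 : ℝ) ^ (2 * n + 2) = 4 * (2 ^ n * 2 ^ n) := by ring
  have hone : (1 : ℝ) ≤ 2 ^ n := one_le_pow₀ one_le_two
  have hmain := two_pow_card_le_of_approx (n := n) (Bm := ⌊Y⌋₊)
    (Q := 2 ^ (2 * (n * (D + 8)) + 2 * n + 4)) (Λ := Λ) (e := e) (x := x) (r := r) (ζ := ζ)
    (K := fun s => hyperbolicityCone (p s) e) hr0 hη he1 hx1 heK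
    (fun s S hS => (htest s S hS).1) (fun s S hS => (htest s S hS).2)
    (fun s => by
      obtain ⟨B, hB, A, hA⟩ := hcon (p s) e (hp s)
      exact ⟨B, Nat.le_floor hB, A, hA⟩)
    (by positivity)
    (by
      rw [hζ, h4n, mul_div_assoc', div_lt_one (by positivity)]
      nlinarith [mul_le_mul hn2 hr1 hr0.le (by positivity)])
    (by
      have : (n : ℝ) * ζ * ⌊Y⌋₊ = r * (n * ⌊Y⌋₊) / (4 * (2 ^ n * 2 ^ n)) := by
        rw [hζ, h4n]; ring
      rw [this, div_le_div_iff₀ (by positivity) two_pos]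
      have := mul_le_mul_of_nonneg_left (mul_le_mul hn2 hB2 (by positivity) (by positivity)) hr0.le
      nlinarith [mul_pos hr0 (show (0 : ℝ) < 2 ^ n * 2 ^ n by positivity)])
    (by
      have h1 : 1 / (r / 2) / ζ = 2 ^ (2 * (n * (D + 8)) + 2 * n + 3) := by
        rw [hζ, hrpow]; field_simp; ring
      rw [h1]
      push_cast
      rw [pow_succ _ (2 * (n * (D + 8)) + 2 * n + 3)]
      have : (1 : ℝ) ≤ 2 ^ (2 * (n * (D + 8)) + 2 * n + 3) := one_le_pow₀ one_le_two
      linarith)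
  set Bm := ⌊Y⌋₊ with hBm
  set q := 2 * (n * (D + 8)) + 2 * n + 4 with hq
  -- Bounding every factor of the code count by a power of two turns the inequality into one between
  -- exponents.
  have hle : 2 ^ Λ.card ≤ 2 ^ (Bm + (q + 2) * Bm * Bm * n) := by
    refine hmain.trans ?_
    have hpow : 2 ^ (Bm + (q + 2) * Bm * Bm * n) = 2 ^ Bm * (((2 ^ (q + 2)) ^ Bm) ^ Bm) ^ n := by
      rw [pow_add, pow_mul, pow_mul, pow_mul]
    rw [hpow]
    have h1 : 2 * 2 ^ q + 1 ≤ 2 ^ (q + 2) := by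
      have := Nat.one_le_two_pow (n := q)
      linarith [pow_succ 2 (q + 1), pow_succ 2 q]
    exact Nat.mul_le_mul Nat.lt_two_pow_self (Nat.pow_le_pow_left (Nat.pow_le_pow_left
      (Nat.pow_le_pow_left h1 _) _) _)
  have hle' := (Nat.pow_le_pow_iff_right one_lt_two).1 hle
  have hq2 : q + 2 ≤ 21 * n ^ 2 := by
    have h1 : 2 * (n * D) ≤ n * n := by
      have : 2 * D ≤ n := by omega
      nlinarith
    nlinarith
  have hfinal : Λ.card ≤ 22 * n ^ 3 * Bm ^ 2 := by
    refine hle'.trans ?_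
    have h1 : (q + 2) * Bm * Bm * n ≤ 21 * n ^ 2 * Bm * Bm * n := by gcongr
    have h2 : Bm ≤ n ^ 3 * Bm ^ 2 := by
      have : Bm ≤ Bm ^ 2 := Nat.le_self_pow two_ne_zero _
      exact this.trans (Nat.le_mul_of_pos_left _ (pow_pos (by omega) 3))
    calc Bm + (q + 2) * Bm * Bm * n ≤ n ^ 3 * Bm ^ 2 + 21 * n ^ 2 * Bm * Bm * n := add_le_add h2 h1
      _ = 22 * n ^ 3 * Bm ^ 2 := by ring
  have hlt := hN₁ n d hn.2 hd.2
  rw [← hD, ← hcard] at hlt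
  have hcast : (Λ.card : ℝ) ≤ 22 * n ^ 3 * (Bm : ℝ) ^ 2 := by exact_mod_cast hfinal
  have hsq : (Bm : ℝ) ^ 2 ≤ Y ^ 2 := pow_le_pow_left₀ (by positivity) hBY 2
  have := mul_le_mul_of_nonneg_left hsq (show (0 : ℝ) ≤ 22 * (n : ℝ) ^ 3 by positivity)
  linarith
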